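/- Let $U\subseteq\mathbb R^2$ be open and let $A_0,A_1,A_2,B_0,\dots,B_7$ be $C^\infty$ functions of $(x,y)\in U$ with $A_2\neq 0$ on $U$. Consider the fourth-order equation $$y''''+(A_2y'^2-A_1y'+A_0)y'''+B_7y'^7-B_6y'^6+B_5y'^5-B_4y'^4+B_3y'^3-B_2y'^2+B_1y'-B_0=0 \qquad (\ast)$$ and define $$c=\tfrac{A_2}{3},\quad g=\tfrac{A_1}{2},\quad h=A_0,$$ $$d=\frac{1}{4cA_2}\Big(B_4-8cA_1A_0-\tfrac14A_1^3+3A_1c_x-7A_0c_y+2cA_{1x}-\tfrac54A_1A_{1y}-3cA_{0y}+2c_{xy}-\tfrac12A_{1yy}\Big).$$ Suppose that on $U$ the constraints $$B_7=6c^3,\qquad B_6=7c(cA_1+c_y),\qquad B_5=4cA_2A_0+\tfrac52cA_1^2-6cc_x+\tfrac72A_1c_y+\tfrac52cA_{1y}+c_{yy},$$ $$B_3=8cA_1d+6cA_0^2+A_1^2A_0-6A_0c_x+7dc_y-A_1A_{1x}+\tfrac52A_0A_{1y}-2cA_{0x}+\tfrac32A_1A_{0y}+cd_y+c_{xx}-A_{1xy}+A_{0yy},$$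 $$B_2=12cA_0d+A_1^2d+A_1A_0^2-6dc_x-2A_0A_{1x}+\tfrac52dA_{1y}-A_1A_{0x}+3A_0A_{0y}+\tfrac12A_1d_y+\tfrac12A_{1xx}-2A_{0xy}+d_{yy},$$ $$B_1=6cd^2+2A_1A_0d-2dA_{1x}-2A_0A_{0x}+3dA_{0y}+A_0d_y+A_{0xx}-2d_{xy},$$ $$B_0=d(A_1d+d_y-2A_{0x})+d_{xx}$$ hold, together with Lie's linearizability criteria $$3(ch)_x+3dc_y+6cd_y-2gg_x-gh_y-3c_{xx}-2g_{xy}-h_{yy}=0,$$ $$3(dg)_y+3cd_x+6dc_x-2hh_y-hg_x-3d_{yy}-2h_{xy}-g_{xx}=0.$$ Then $(\ast)$ is linearizable conditionally on the root equation $$E[y]:=y''+cy'^3-gy'^2+hy'-d=0,$$ that is: 1. $(\ast)$ arises from the twice-differentiated root equation by substituting the root equation for $y''$: for every $C^4$ function $y$ on an open set with graph in $U$, at every $x$ with $E[y](x)=0$ the left-hand side of $(\ast)$ equals $\frac{d^2}{dx^2}E[y](x)$. Every $C^2$ solution of the root equation is a ($C^4$) solution of $(\ast)$. 2. Every point of $U$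 has an open neighbourhood $V\subseteq U$ with an invertible smooth point transformation $t=X(x,y)$, $u=Y(x,y)$ (injective, with nowhere vanishing Jacobian) that carries the root equation into the linear equation $u_{tt}=0$: for $C^2$ functions $y$ with graph in $V$ and $\frac{d}{dx}X(x,y(x))\neq0$, whose graph is carried to the graph of $u$, one has $E[y](x)=0$ if and only if $u_{tt}=0$ at $t=X(x,y(x))$; and, over intervals, the solutions of the root equation with graph in $V$ are exactly the $C^2$ functions $y$ with $kX(x,y(x))+lY(x,y(x))=m$ for some constants $k,l,m$, $(k,l)\neq(0,0)$. 3. Metric consistency. Call smooth functions $a,b,e,f,p,q,r$ on an open $W\subseteq U$ consistent if $h=a-2e$, $g=f-2b$, $pr-q^2\neq0$, the connection with Christoffel symbols $\Gamma^1_{11}=-a$, $\Gamma^1_{12}=-b$, $\Gamma^1_{22}=-c$, $\Gamma^2_{11}=-d$, $\Gamma^2_{12}=-e$, $\Gamma^2_{22}=-f$ is flat, i.e. $$a_y-b_x+be-cd=0,\quad b_y-c_x+(ac-b^2)+(bf-ce)=0,\quad d_y-e_x-(ae-bd)-(df-e^2)=0,\quad (b+f)_x=(a+e)_y,$$ and these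 are the Christoffel symbols of the metric $p\,dx^2+2q\,dx\,dy+r\,dy^2$, i.e. $$p_x=-2(ap+dq),\quad q_x=-bp-(a+e)q-dr,\quad r_x=-2(bq+er),$$ $$p_y=-2(bp+eq),\quad q_y=-cp-(b+f)q-er,\quad r_y=-2(cq+fr).$$ Every point of $U$ has an open neighbourhood $W\subseteq U$ on which consistent functions exist; and for every open $W\subseteq U$ and every consistent choice on $W$, each point of $W$ has an open neighbourhood $V\subseteq W$ with Cartesian coordinates $X,Y$ for that metric (the metric is $\pm dX^2\pm dY^2$ on $V$), and $(X,Y)$ linearizes the root equation on $V$ in the sense of 2. -/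

import Mathlib

open Set
open scoped ContDiff

noncomputable section

namespace CondLin

/-- Partial derivative in the first variable of a function of `(x, y)`. -/
def px (F : ℝ × ℝ → ℝ) : ℝ × ℝ → ℝ := fun z => deriv (fun s => F (s, z.2)) z.1

/-- Partial derivative in the second variable of a function of `(x, y)`. -/
def py (F : ℝ × ℝ → ℝ) : ℝ × ℝ → ℝ := fun z => deriv (fun s => F (z.1, s)) z.2

/-- `F` is infinitely differentiable on `U`. -/
def Smooth (F : ℝ × ℝ → ℝ) (U : Set (ℝ × ℝ)) : Prop := ContDiffOn ℝ ∞ F U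

/-- The graph of `y` over `I` lies in `U`. -/
def GraphIn (y : ℝ → ℝ) (I : Set ℝ) (U : Set (ℝ × ℝ)) : Prop := ∀ x ∈ I, (x, y x) ∈ U

/-- Coefficients of a cubically semi-linear second order equation
`y_xx + c y_x^3 - g y_x^2 + h y_x - d = 0`. -/
structure Root where
  c : ℝ × ℝ → ℝ
  g : ℝ × ℝ → ℝ
  h : ℝ × ℝ → ℝ
  d : ℝ × ℝ → ℝ

/-- Coefficients of a fourth order equation
`y_xxxx + (A2 y_x^2 - A1 y_x + A0) y_xxx + B7 y_x^7 - B6 y_x^6 + B5 y_x^5 - B4 y_x^4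
  + B3 y_x^3 - B2 y_x^2 + B1 y_x - B0 = 0`. -/
structure FourthOrder where
  A0 : ℝ × ℝ → ℝ
  A1 : ℝ × ℝ → ℝ
  A2 : ℝ × ℝ → ℝ
  B0 : ℝ × ℝ → ℝ
  B1 : ℝ × ℝ → ℝ
  B2 : ℝ × ℝ → ℝ
  B3 : ℝ × ℝ → ℝ
  B4 : ℝ × ℝ → ℝ
  B5 : ℝ × ℝ → ℝ
  B6 : ℝ × ℝ → ℝ
  B7 : ℝ × ℝ → ℝ

/-- Left-hand side of the second order equation, evaluated along `y` at `x`. -/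
def Root.lhs (R : Root) (y : ℝ → ℝ) (x : ℝ) : ℝ :=
  iteratedDeriv 2 y x + R.c (x, y x) * deriv y x ^ 3 - R.g (x, y x) * deriv y x ^ 2
    + R.h (x, y x) * deriv y x - R.d (x, y x)

/-- `y` is a (classical) solution on `I` of the second order equation considered on `U`. -/
def Root.IsSolution (R : Root) (U : Set (ℝ × ℝ)) (I : Set ℝ) (y : ℝ → ℝ) : Prop :=
  ContDiffOn ℝ 2 y I ∧ GraphIn y I U ∧ ∀ x ∈ I, R.lhs y x = 0

/-- Left-hand side of the fourth order equation, evaluated along `y` at `x`. -/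
def FourthOrder.lhs (Q : FourthOrder) (y : ℝ → ℝ) (x : ℝ) : ℝ :=
  iteratedDeriv 4 y x
    + (Q.A2 (x, y x) * deriv y x ^ 2 - Q.A1 (x, y x) * deriv y x + Q.A0 (x, y x))
        * iteratedDeriv 3 y x
    + Q.B7 (x, y x) * deriv y x ^ 7 - Q.B6 (x, y x) * deriv y x ^ 6
    + Q.B5 (x, y x) * deriv y x ^ 5 - Q.B4 (x, y x) * deriv y x ^ 4
    + Q.B3 (x, y x) * deriv y x ^ 3 - Q.B2 (x, y x) * deriv y x ^ 2
    + Q.B1 (x, y x) * deriv y x - Q.B0 (x, y x)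

/-- `y` is a (classical) solution on `I` of the fourth order equation considered on `U`. -/
def FourthOrder.IsSolution (Q : FourthOrder) (U : Set (ℝ × ℝ)) (I : Set ℝ) (y : ℝ → ℝ) : Prop :=
  ContDiffOn ℝ 4 y I ∧ GraphIn y I U ∧ ∀ x ∈ I, Q.lhs y x = 0

/-- All coefficients of the fourth order equation are smooth on `U`. -/
def FourthOrder.SmoothOn (Q : FourthOrder) (U : Set (ℝ × ℝ)) : Prop :=
  Smooth Q.A0 U ∧ Smooth Q.A1 U ∧ Smooth Q.A2 U ∧ Smooth Q.B0 U ∧ Smooth Q.B1 U ∧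
  Smooth Q.B2 U ∧ Smooth Q.B3 U ∧ Smooth Q.B4 U ∧ Smooth Q.B5 U ∧ Smooth Q.B6 U ∧ Smooth Q.B7 U

/-- The root coefficient `c` read off from the fourth order equation. -/
def FourthOrder.c (Q : FourthOrder) : ℝ × ℝ → ℝ := fun z => Q.A2 z / 3

/-- The root coefficient `d` read off from the fourth order equation
(meaningful where `A2` does not vanish). -/
def FourthOrder.d (Q : FourthOrder) : ℝ × ℝ → ℝ := fun z =>
  (Q.B4 z - 8 * Q.c z * Q.A1 z * Q.A0 z - Q.A1 z ^ 3 / 4 + 3 * Q.A1 z * px Q.c z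
    - 7 * Q.A0 z * py Q.c z + 2 * Q.c z * px Q.A1 z - 5 / 4 * Q.A1 z * py Q.A1 z
    - 3 * Q.c z * py Q.A0 z + 2 * py (px Q.c) z - py (py Q.A1) z / 2) / (4 * Q.c z * Q.A2 z)

/-- The root equation whose four coefficients are identified from the fourth order equation. -/
def FourthOrder.root (Q : FourthOrder) : Root where
  c := Q.c
  g := fun z => Q.A1 z / 2
  h := Q.A0
  d := Q.d

/-- The differential constraints on the remaining coefficients, on `U`. -/
structure FourthOrder.Constraints (Q : FourthOrder) (U : Set (ℝ × ℝ)) : Prop where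
  b7 : ∀ z ∈ U, Q.B7 z = 6 * Q.c z ^ 3
  b6 : ∀ z ∈ U, Q.B6 z = 7 * Q.c z * (Q.c z * Q.A1 z + py Q.c z)
  b5 : ∀ z ∈ U, Q.B5 z = 4 * Q.c z * Q.A2 z * Q.A0 z + 5 / 2 * Q.c z * Q.A1 z ^ 2
    - 6 * Q.c z * px Q.c z + 7 / 2 * Q.A1 z * py Q.c z + 5 / 2 * Q.c z * py Q.A1 z
    + py (py Q.c) z
  b3 : ∀ z ∈ U, Q.B3 z = 8 * Q.c z * Q.A1 z * Q.d z + 6 * Q.c z * Q.A0 z ^ 2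
    + Q.A1 z ^ 2 * Q.A0 z - 6 * Q.A0 z * px Q.c z + 7 * Q.d z * py Q.c z - Q.A1 z * px Q.A1 z
    + 5 / 2 * Q.A0 z * py Q.A1 z - 2 * Q.c z * px Q.A0 z + 3 / 2 * Q.A1 z * py Q.A0 z
    + Q.c z * py Q.d z + px (px Q.c) z - py (px Q.A1) z + py (py Q.A0) z
  b2 : ∀ z ∈ U, Q.B2 z = 12 * Q.c z * Q.A0 z * Q.d z + Q.A1 z ^ 2 * Q.d z
    + Q.A1 z * Q.A0 z ^ 2 - 6 * Q.d z * px Q.c z - 2 * Q.A0 z * px Q.A1 z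
    + 5 / 2 * Q.d z * py Q.A1 z - Q.A1 z * px Q.A0 z + 3 * Q.A0 z * py Q.A0 z
    + Q.A1 z * py Q.d z / 2 + px (px Q.A1) z / 2 - 2 * py (px Q.A0) z + py (py Q.d) z
  b1 : ∀ z ∈ U, Q.B1 z = 6 * Q.c z * Q.d z ^ 2 + 2 * Q.A1 z * Q.A0 z * Q.d z
    - 2 * Q.d z * px Q.A1 z - 2 * Q.A0 z * px Q.A0 z + 3 * Q.d z * py Q.A0 z
    + Q.A0 z * py Q.d z + px (px Q.A0) z - 2 * py (px Q.d) z
  b0 : ∀ z ∈ U, Q.B0 z = Q.d z * (Q.A1 z * Q.d z + py Q.d z - 2 * px Q.A0 z) + px (px Q.d) z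

/-- Lie's linearizability criteria for the second order equation, on `U`. -/
structure Root.LieCriteria (R : Root) (U : Set (ℝ × ℝ)) : Prop where
  first : ∀ z ∈ U, 3 * px (fun w => R.c w * R.h w) z + 3 * R.d z * py R.c z
    + 6 * R.c z * py R.d z - 2 * R.g z * px R.g z - R.g z * py R.h z
    - 3 * px (px R.c) z - 2 * py (px R.g) z - py (py R.h) z = 0
  second : ∀ z ∈ U, 3 * py (fun w => R.d w * R.g w) z + 3 * R.c z * px R.d z
    + 6 * R.d z * px R.c z - 2 * R.h z * py R.h z - R.h z * px R.g z
    - 3 * py (py R.d) z - 2 * py (px R.h) z - px (px R.g) z = 0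

/-- The fourth order equation comes from the second derivative of the root equation by replacing
the second derivative of `y` through the root equation: at any single point where the root
expression vanishes along `y`, the fourth order expression equals the second derivative of the
root expression. (The root equation is required at `x` only, so the values there of the third and
fourth derivatives of `y` are unrestricted.) -/
def FourthOrder.ArisesFrom (Q : FourthOrder) (R : Root) (U : Set (ℝ × ℝ)) : Prop :=
  ∀ (I : Set ℝ) (y : ℝ → ℝ), IsOpen I → ContDiffOn ℝ 4 y I → GraphIn y I U →
    ∀ x ∈ I, R.lhs y x = 0 → Q.lhs y x = iteratedDeriv 2 (R.lhs y) x

/-- `t = X(x, y)`, `u = Y(x, y)` is an invertible smooth point transformation on `V`. -/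
structure IsPointTransformation (X Y : ℝ × ℝ → ℝ) (V : Set (ℝ × ℝ)) : Prop where
  smooth_X : Smooth X V
  smooth_Y : Smooth Y V
  inj : InjOn (fun z => (X z, Y z)) V
  jacobian : ∀ z ∈ V, px X z * py Y z - py X z * px Y z ≠ 0

/-- The point transformation `t = X(x, y)`, `u = Y(x, y)` on `V` carries the second order equation
into the linear equation `u_tt = 0`. -/
structure Root.LinearizedBy (R : Root) (X Y : ℝ × ℝ → ℝ) (V : Set (ℝ × ℝ)) : Prop where
  point : IsPointTransformation X Y V
  /-- whenever the transformed graph of `y` is the graph of a function `u` of `t`, the equation for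
  `y` holds at a point exactly if `u_tt` vanishes at the corresponding point -/
  equiv : ∀ (I : Set ℝ) (y u : ℝ → ℝ), IsOpen I → ContDiffOn ℝ 2 y I → GraphIn y I V →
    (∀ x ∈ I, deriv (fun s => X (s, y s)) x ≠ 0) →
    (∀ x ∈ I, u (X (x, y x)) = Y (x, y x)) →
    ∀ x ∈ I, R.lhs y x = 0 ↔ iteratedDeriv 2 u (X (x, y x)) = 0
  /-- the general solution: the graphs of solutions are exactly those carried into a line -/
  lines : ∀ (I : Set ℝ) (y : ℝ → ℝ), IsOpen I → IsPreconnected I → ContDiffOn ℝ 2 y I →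
    GraphIn y I V →
    ((∀ x ∈ I, R.lhs y x = 0) ↔
      ∃ k l m : ℝ, (k ≠ 0 ∨ l ≠ 0) ∧ ∀ x ∈ I, k * X (x, y x) + l * Y (x, y x) = m)

/-- The fourth order equation is linearizable conditionally on the second order equation `R`:
it arises from `R`, every solution of `R` solves it, and `R` is linearizable by a point
transformation near every point of `U`. -/
structure FourthOrder.ConditionallyLinearizable (Q : FourthOrder) (R : Root) (U : Set (ℝ × ℝ)) :
    Prop where
  arises : Q.ArisesFrom R U
  solutions : ∀ (I : Set ℝ) (y : ℝ → ℝ), IsOpen I → R.IsSolution U I y → Q.IsSolution U I y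
  linearizable : ∀ z ∈ U, ∃ (V : Set (ℝ × ℝ)) (X Y : ℝ × ℝ → ℝ),
    IsOpen V ∧ z ∈ V ∧ V ⊆ U ∧ R.LinearizedBy X Y V

/-- The remaining coefficients `a, b, e, f` of a system of geodesic type
`x_ss = a x_s^2 + 2 b x_s y_s + c y_s^2`, `y_ss = d x_s^2 + 2 e x_s y_s + f y_s^2`
(the negatives of Christoffel symbols) with metric `p dx^2 + 2 q dx dy + r dy^2`. -/
structure Geometry where
  a : ℝ × ℝ → ℝ
  b : ℝ × ℝ → ℝ
  e : ℝ × ℝ → ℝ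
  f : ℝ × ℝ → ℝ
  p : ℝ × ℝ → ℝ
  q : ℝ × ℝ → ℝ
  r : ℝ × ℝ → ℝ

/-- On `W`, the geodesic system with coefficients `a, b, c, d, e, f` projects to the second order
equation `R`, has zero curvature, and its Christoffel symbols are those of the nondegenerate
metric with coefficients `p, q, r`. -/
structure Geometry.Consistent (G : Geometry) (R : Root) (W : Set (ℝ × ℝ)) : Prop where
  smooth : Smooth G.a W ∧ Smooth G.b W ∧ Smooth G.e W ∧ Smooth G.f W ∧
    Smooth G.p W ∧ Smooth G.q W ∧ Smooth G.r W
  proj_h : ∀ z ∈ W, R.h z = G.a z - 2 * G.e z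
  proj_g : ∀ z ∈ W, R.g z = G.f z - 2 * G.b z
  flat1 : ∀ z ∈ W, py G.a z - px G.b z + G.b z * G.e z - R.c z * R.d z = 0
  flat2 : ∀ z ∈ W, py G.b z - px R.c z + (G.a z * R.c z - G.b z ^ 2)
    + (G.b z * G.f z - R.c z * G.e z) = 0
  flat3 : ∀ z ∈ W, py R.d z - px G.e z - (G.a z * G.e z - G.b z * R.d z)
    - (R.d z * G.f z - G.e z ^ 2) = 0
  flat4 : ∀ z ∈ W, px (fun w => G.b w + G.f w) z = py (fun w => G.a w + G.e w) z
  p_x : ∀ z ∈ W, px G.p z = -2 * (G.a z * G.p z + R.d z * G.q z)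
  q_x : ∀ z ∈ W, px G.q z = -(G.b z * G.p z) - (G.a z + G.e z) * G.q z - R.d z * G.r z
  r_x : ∀ z ∈ W, px G.r z = -2 * (G.b z * G.q z + G.e z * G.r z)
  p_y : ∀ z ∈ W, py G.p z = -2 * (G.b z * G.p z + G.e z * G.q z)
  q_y : ∀ z ∈ W, py G.q z = -(R.c z * G.p z) - (G.b z + G.f z) * G.q z - G.e z * G.r z
  r_y : ∀ z ∈ W, py G.r z = -2 * (R.c z * G.q z + G.f z * G.r z)
  nondeg : ∀ z ∈ W, G.p z * G.r z - G.q z ^ 2 ≠ 0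

/-- `X, Y` are Cartesian coordinates on `V` for the metric: it equals `± dX^2 ± dY^2`. -/
def Geometry.IsCartesian (G : Geometry) (X Y : ℝ × ℝ → ℝ) (V : Set (ℝ × ℝ)) : Prop :=
  ∃ s t : ℝ, (s = 1 ∨ s = -1) ∧ (t = 1 ∨ t = -1) ∧ ∀ z ∈ V,
    G.p z = s * px X z ^ 2 + t * px Y z ^ 2 ∧
    G.q z = s * (px X z * py X z) + t * (px Y z * py Y z) ∧
    G.r z = s * py X z ^ 2 + t * py Y z ^ 2

end CondLin

end

/-! The first assertion is a computation. Differentiating $E[y]$ twice and replacing only $y''$ by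
the cubic in $y'$ gives a polynomial in $y'$, affine in $y'''$ and $y''''$. Comparing coefficients
gives the constraints, and the power $y'^4$ is accounted for by the definition of $d$
(`FourthOrder.Constraints.lhs_eq`). Solutions of the root equation gain regularity by bootstrapping.

The rest is geometry. With $a=h+2e$ and $f=g+2b$ the root equation is the projection to graphs of
the geodesic equations of a symmetric connection, in which $b,e$ are still free. Flatness with
symmetric Ricci tensor prescribes all first derivatives of $b$ and $e$, and Lie's criteria are
exactly the compatibility conditions of that system (`Root.LieCriteria.exists_isFlatLift`). A flat
connection has local affine functions, those with zero covariant Hessian, with arbitrary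
differential at a point (`Geometry.IsFlatOn.exists_isAffineOn`). Both existence statements are
instances of a Frobenius theorem, `exists_solution_total_differential`.

If $X$ is affine and $\varphi(x)=X(x,y(x))$, then $\varphi''=-(a+2by'+cy'^2)\varphi'+X_yE[y]$
(`Geometry.IsAffineOn.hasDerivAt_velocity`). The factor of $\varphi'$ is the same for every affine
function. Hence for two of them with nonzero Jacobian the acceleration of the curve $(X,Y)$ is
parallel to its velocity exactly where $E[y]=0$, which yields both $u_{tt}=0$ and the description of
solutions as straight lines.

For the metric, $\pm dX^2\pm dY^2$ is parallel when $X,Y$ are affine, which produces a consistent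
metric. Conversely a given consistent metric is diagonalized at one point, and affine functions are
chosen with the differentials found there. Their form and the metric are both parallel and agree at
the point, so they agree nearby (`Geometry.IsParallelOn.eqOn`). -/

namespace CondLin

open Metric Filter Topology NNReal

/-! ### Frobenius theorem for total differential systems in the plane. -/

section TotalDifferential

variable {E : Type*} [NormedAddCommGroup E] [NormedSpace ℝ E]

/-- The Picard–Lindelöf theorem on a symmetric interval, with control of the range. -/
theorem exists_solution_mem_closedBall [CompleteSpace E] {f : ℝ → E → E} {t₀ ε : ℝ} (hε : 0 < ε)
    {x₀ x : E} {a r L K : ℝ≥0}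
    (hlip : ∀ t ∈ Icc (t₀ - ε) (t₀ + ε), LipschitzOnWith K (f t) (closedBall x₀ a))
    (hcont : ∀ x ∈ closedBall x₀ a, ContinuousOn (f · x) (Icc (t₀ - ε) (t₀ + ε)))
    (hnorm : ∀ t ∈ Icc (t₀ - ε) (t₀ + ε), ∀ x ∈ closedBall x₀ a, ‖f t x‖ ≤ L)
    (hle : L * ε ≤ a - r) (hx : x ∈ closedBall x₀ r) :
    ∃ α : ℝ → E, α t₀ = x ∧ ∀ t ∈ Icc (t₀ - ε) (t₀ + ε), α t ∈ closedBall x₀ a ∧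
      HasDerivWithinAt α (f t (α t)) (Icc (t₀ - ε) (t₀ + ε)) t := by
  have ht₀ : t₀ ∈ Icc (t₀ - ε) (t₀ + ε) := by simp [hε.le]
  have hf : IsPicardLindelof f (tmin := t₀ - ε) (tmax := t₀ + ε) ⟨t₀, ht₀⟩ x₀ a r L K :=
    ⟨hlip, hcont, hnorm, by simpa using hle⟩
  -- Working with the fixed point of the Picard map itself keeps the bound that its curve stays in
  -- the ball of radius `a`.
  obtain ⟨α, hα⟩ := ODE.FunSpace.exists_isFixedPt_next hf hx
  refine ⟨α.compProj, ?_, fun t ht ↦ ⟨α.compProj_mem_closedBall hf.mul_max_le, ?_⟩⟩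
  · have := α.compProj_val (t := ⟨t₀, ht₀⟩)
    rw [this, ← hα, ODE.FunSpace.next_apply₀]
  · refine (ODE.hasDerivWithinAt_picard_Icc ht₀ hf.continuousOn_uncurry
      α.continuous_compProj.continuousOn (fun _ _ ↦ α.compProj_mem_closedBall hf.mul_max_le)
      x ht).congr_of_mem (fun t' ht' ↦ ?_) ht
    nth_rw 1 [← hα]
    rw [ODE.FunSpace.compProj_of_mem ht', ODE.FunSpace.next_apply]

/-- Grönwall's inequality on both sides of the initial time. -/
theorem norm_le_gronwallBound_of_mem_Icc {f f' : ℝ → E} {t₀ ε K δ η : ℝ}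
    (hf : ∀ t ∈ Icc (t₀ - ε) (t₀ + ε), HasDerivWithinAt f (f' t) (Icc (t₀ - ε) (t₀ + ε)) t)
    (h₀ : ‖f t₀‖ ≤ δ) (bound : ∀ t ∈ Icc (t₀ - ε) (t₀ + ε), ‖f' t‖ ≤ K * ‖f t‖ + η)
    {t : ℝ} (ht : t ∈ Icc (t₀ - ε) (t₀ + ε)) : ‖f t‖ ≤ gronwallBound δ K η |t - t₀| := by
  have key : ∀ (g g' : ℝ → E),
      (∀ t ∈ Icc (t₀ - ε) (t₀ + ε), HasDerivWithinAt g (g' t) (Icc (t₀ - ε) (t₀ + ε)) t) →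
      ‖g t₀‖ ≤ δ → (∀ t ∈ Icc (t₀ - ε) (t₀ + ε), ‖g' t‖ ≤ K * ‖g t‖ + η) →
      ∀ t ∈ Icc t₀ (t₀ + ε), ‖g t‖ ≤ gronwallBound δ K η (t - t₀) := by
    intro g g' hg hg0 hb t ht
    have hε : 0 ≤ ε := by linarith [ht.1, ht.2]
    have hsub : Icc t₀ (t₀ + ε) ⊆ Icc (t₀ - ε) (t₀ + ε) := Icc_subset_Icc (by linarith) le_rfl
    refine norm_le_gronwallBound_of_norm_deriv_right_le
      (fun s hs ↦ ((hg s (hsub hs)).continuousWithinAt.mono hsub)) (fun s hs ↦ ?_) hg0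
      (fun s hs ↦ hb s (hsub ⟨hs.1, hs.2.le⟩)) t ht
    refine (hg s (hsub ⟨hs.1, hs.2.le⟩)).mono_of_mem_nhdsWithin ?_
    exact mem_of_superset (Icc_mem_nhdsGE hs.2) (Icc_subset_Icc (by linarith [hs.1]) le_rfl)
  rcases le_total t₀ t with h | h
  · rw [abs_of_nonneg (by linarith)]
    exact key f f' hf h₀ bound t ⟨h, ht.2⟩
  -- Times before `t₀` are reduced to later ones by reflection in `t₀`.
  · have hmaps : MapsTo (fun s ↦ 2 * t₀ - s) (Icc (t₀ - ε) (t₀ + ε)) (Icc (t₀ - ε) (t₀ + ε)) :=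
      fun s hs ↦ ⟨by linarith [hs.2], by linarith [hs.1]⟩
    have := key (fun s ↦ f (2 * t₀ - s)) (fun s ↦ -f' (2 * t₀ - s)) (fun s hs ↦ ?_)
      (by simpa [two_mul] using h₀) (fun s hs ↦ by simpa using bound _ (hmaps hs))
      (2 * t₀ - t) ⟨by linarith, by linarith [ht.1]⟩
    · rw [abs_of_nonpos (by linarith)]
      convert this using 2 <;> ring_nf
    · have h1 : HasDerivWithinAt (fun s ↦ 2 * t₀ - s) (-1) (Icc (t₀ - ε) (t₀ + ε)) s :=
        (hasDerivWithinAt_id s _).const_sub _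
      have h2 := (hf _ (hmaps hs)).scomp s h1 hmaps
      rwa [neg_one_smul] at h2

/-- First order Taylor estimate for a curve whose velocity depends Lipschitz continuously on time
and position. -/
theorem norm_sub_sub_smul_le_of_lipschitz_velocity {f f' : ℝ → E} {s : Set ℝ} (hs : Convex ℝ s)
    {C K : ℝ} (hC : 1 ≤ C) (hK : 0 ≤ K) (hf : ∀ t ∈ s, HasDerivWithinAt f (f' t) s t)
    (hbd : ∀ t ∈ s, ‖f' t‖ ≤ C)
    (hlip : ∀ t ∈ s, ∀ τ ∈ s, ‖f' τ - f' t‖ ≤ K * max |τ - t| ‖f τ - f t‖)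
    {t t' : ℝ} (ht : t ∈ s) (ht' : t' ∈ s) :
    ‖f t' - f t - (t' - t) • f' t‖ ≤ K * C * (t' - t) ^ 2 := by
  have hl : ∀ τ ∈ s, ‖f τ - f t‖ ≤ C * |τ - t| := fun τ hτ ↦ by
    simpa using hs.norm_image_sub_le_of_norm_hasDerivWithin_le hf hbd ht hτ
  have hsub : segment ℝ t t' ⊆ s := hs.segment_subset ht ht'
  -- Mean value inequality for the curve minus its tangent line at `t`; the derivative there is a
  -- difference of velocities.
  have := (convex_segment t t').norm_image_sub_le_of_norm_hasDerivWithin_le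
    (f := fun τ ↦ f τ - τ • f' t) (f' := fun τ ↦ f' τ - (1 : ℝ) • f' t) (C := K * (C * |t' - t|))
    (fun τ hτ ↦ ((hf τ (hsub hτ)).mono hsub).sub ((hasDerivWithinAt_id τ _).smul_const _))
    (fun τ hτ ↦ ?_) (left_mem_segment ℝ t t') (right_mem_segment ℝ t t')
  · calc _ = ‖f t' - t' • f' t - (f t - t • f' t)‖ := by congr 1; module
      _ ≤ _ := this
      _ = _ := by rw [Real.norm_eq_abs, ← sq_abs]; ring
  · rw [one_smul]
    refine (hlip t ht τ (hsub hτ)).trans (mul_le_mul_of_nonneg_left ?_ hK)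
    have h1 : |τ - t| ≤ |t' - t| := by
      rw [segment_eq_uIcc] at hτ
      exact abs_sub_left_of_mem_uIcc hτ
    have h0 := abs_nonneg (τ - t)
    refine max_le (by nlinarith) ((hl τ (hsub hτ)).trans (by gcongr))

/-- First order Taylor estimate for a function with Lipschitz derivative. -/
theorem norm_sub_sub_fderiv_le {E' : Type*} [NormedAddCommGroup E'] [NormedSpace ℝ E']
    {G : E' → E} {G' : E' → E' →L[ℝ] E} {s : Set E'} (hs : Convex ℝ s) {K : ℝ≥0}
    (hG : ∀ w ∈ s, HasFDerivAt G (G' w) w) (hlip : LipschitzOnWith K G' s)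
    {w w' : E'} (hw : w ∈ s) (hw' : w' ∈ s) :
    ‖G w' - G w - G' w (w' - w)‖ ≤ K * ‖w' - w‖ ^ 2 := by
  have hsub : segment ℝ w w' ⊆ s := hs.segment_subset hw hw'
  have := (convex_segment w w').norm_image_sub_le_of_norm_hasFDerivWithin_le'
    (fun τ hτ ↦ (hG τ (hsub hτ)).hasFDerivWithinAt) (φ := G' w) (C := K * ‖w' - w‖)
    (fun τ hτ ↦ ?_) (left_mem_segment ℝ w w') (right_mem_segment ℝ w w')
  · exact this.trans_eq (by ring)
  · refine (hlip.norm_sub_le (hsub hτ) hw).trans ?_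
    gcongr
    obtain ⟨θ, hθ, rfl⟩ := (segment_eq_image' ℝ w w').subset hτ
    simp only [add_sub_cancel_left, norm_smul, Real.norm_eq_abs, abs_of_nonneg hθ.1]
    exact mul_le_of_le_one_left (norm_nonneg _) hθ.2

/-- Uniform local bounds for a smooth function. -/
theorem exists_closedBall_bounds {E' : Type*} [NormedAddCommGroup E'] [NormedSpace ℝ E']
    {F : E' → E} {O : Set E'} (hO : IsOpen O) (hF : ContDiffOn ℝ ∞ F O) {w₀ : E'} (hw : w₀ ∈ O) :
    ∃ C K : ℝ≥0, ∀ᶠ R in 𝓝[>] (0 : ℝ), (∀ w ∈ closedBall w₀ R, w ∈ O ∧ ‖F w‖ ≤ C) ∧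
      LipschitzOnWith K F (closedBall w₀ R) ∧ LipschitzOnWith K (fderiv ℝ F) (closedBall w₀ R) := by
  have hFw : ContDiffAt ℝ ∞ F w₀ := hF.contDiffAt (hO.mem_nhds hw)
  have hF' : ContDiffAt ℝ 1 (fderiv ℝ F) w₀ := hFw.fderiv_right (m := 1) (by norm_cast)
  obtain ⟨K₁, s₁, hs₁, hl₁⟩ := (hFw.of_le (m := 1) (by norm_cast)).exists_lipschitzOnWith
  obtain ⟨K₂, s₂, hs₂, hl₂⟩ := hF'.exists_lipschitzOnWith
  have hb : ∀ᶠ w in 𝓝 w₀, ‖F w‖ < ‖F w₀‖₊ + 1 :=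
    hFw.continuousAt.norm.eventually_lt continuousAt_const (by simp)
  have hmem : ∀ᶠ w in 𝓝 w₀, w ∈ s₁ ∧ w ∈ s₂ ∧ w ∈ O ∧ ‖F w‖ < ‖F w₀‖₊ + 1 := by
    filter_upwards [hs₁, hs₂, hO.mem_nhds hw, hb] with w h1 h2 h3 h4 using ⟨h1, h2, h3, h4⟩
  obtain ⟨ρ, hρ, hball⟩ := Metric.eventually_nhds_iff_ball.1 hmem
  refine ⟨‖F w₀‖₊ + 1, max K₁ K₂, ?_⟩
  filter_upwards [Ioo_mem_nhdsGT hρ] with R hR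
  have hsub : ∀ w ∈ closedBall w₀ R, w ∈ s₁ ∧ w ∈ s₂ ∧ w ∈ O ∧ ‖F w‖ < ‖F w₀‖₊ + 1 :=
    fun w hw ↦ hball w (closedBall_subset_ball hR.2 hw)
  exact ⟨fun w hw ↦ ⟨(hsub w hw).2.2.1, by simpa using (hsub w hw).2.2.2.le⟩,
    (hl₁.mono fun w hw ↦ (hsub w hw).1).weaken (le_max_left _ _),
    (hl₂.mono fun w hw ↦ (hsub w hw).2.1).weaken (le_max_right _ _)⟩

/-- A solution of a smooth total differential system is smooth. -/
theorem contDiffOn_of_total_differential {O : Set ((ℝ × ℝ) × E)} {F G : (ℝ × ℝ) × E → E}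
    (hF : ContDiffOn ℝ ∞ F O) (hG : ContDiffOn ℝ ∞ G O) {V : Set (ℝ × ℝ)} (hV : IsOpen V)
    {v : ℝ × ℝ → E} (hmem : ∀ z ∈ V, (z, v z) ∈ O)
    (hv : ∀ z ∈ V, HasFDerivAt v ((ContinuousLinearMap.fst ℝ ℝ ℝ).smulRight (F (z, v z))
      + (ContinuousLinearMap.snd ℝ ℝ ℝ).smulRight (G (z, v z))) z) : ContDiffOn ℝ ∞ v V := by
  rw [contDiffOn_infty]
  intro n
  induction n with
  | zero => exact contDiffOn_zero.2 fun z hz ↦ (hv z hz).continuousAt.continuousWithinAt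
  -- If `v` is $C^n$, so is the right-hand side of the system, which is the derivative of `v`.
  | succ n ih =>
    have hw : ContDiffOn ℝ n (fun z ↦ (z, v z)) V := contDiffOn_id.prodMk ih
    have hFn : ContDiffOn ℝ n (fun z ↦ F (z, v z)) V :=
      (hF.of_le (by exact_mod_cast le_top)).comp hw hmem
    have hGn : ContDiffOn ℝ n (fun z ↦ G (z, v z)) V :=
      (hG.of_le (by exact_mod_cast le_top)).comp hw hmem
    rw [Nat.cast_add, Nat.cast_one, contDiffOn_succ_iff_fderiv_of_isOpen hV]
    refine ⟨fun z hz ↦ (hv z hz).differentiableAt.differentiableWithinAt, by simp, ?_⟩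
    refine ContDiffOn.congr ?_ fun z hz ↦ (hv z hz).fderiv
    exact (contDiffOn_const.smulRight hFn).add (contDiffOn_const.smulRight hGn)

/-- The Frobenius theorem for a total differential system in two independent variables: if the
smooth system `v_x = F (z, v)`, `v_y = G (z, v)` satisfies the compatibility condition, it has a
smooth local solution with any prescribed value at a point. -/
theorem exists_solution_total_differential [CompleteSpace E] {O : Set ((ℝ × ℝ) × E)}
    (hO : IsOpen O) {F G : (ℝ × ℝ) × E → E} (hF : ContDiffOn ℝ ∞ F O) (hG : ContDiffOn ℝ ∞ G O)
    (hcomp : ∀ w ∈ O, fderiv ℝ F w ((0, 1), G w) = fderiv ℝ G w ((1, 0), F w))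
    {z₀ : ℝ × ℝ} {v₀ : E} (h₀ : (z₀, v₀) ∈ O) :
    ∃ V : Set (ℝ × ℝ), IsOpen V ∧ z₀ ∈ V ∧ ∃ v : ℝ × ℝ → E, v z₀ = v₀ ∧ ContDiffOn ℝ ∞ v V ∧
      ∀ z ∈ V, (z, v z) ∈ O ∧
        HasFDerivAt v ((ContinuousLinearMap.fst ℝ ℝ ℝ).smulRight (F (z, v z))
          + (ContinuousLinearMap.snd ℝ ℝ ℝ).smulRight (G (z, v z))) z := by
  obtain ⟨C₁, K₁, h₁⟩ := exists_closedBall_bounds hO hF h₀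
  obtain ⟨C₂, K₂, h₂⟩ := exists_closedBall_bounds hO hG h₀
  obtain ⟨R, ⟨hF₁, hF₂, -⟩, ⟨hG₁, hG₂, hG₃⟩, hR⟩ := (h₁.and (h₂.and self_mem_nhdsWithin)).exists
  replace hR : 0 < R := hR
  obtain ⟨x₀, y₀⟩ := z₀
  -- The bound is at least 1 so that it also controls the unit motion of the base point, as in `((1,
  -- 0), F w)`.
  obtain ⟨C, hC, hFC, hGC⟩ : ∃ C : ℝ≥0, 1 ≤ C ∧
      (∀ w ∈ closedBall ((x₀, y₀), v₀) R, ‖F w‖ ≤ C) ∧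
      (∀ w ∈ closedBall ((x₀, y₀), v₀) R, ‖G w‖ ≤ C) :=
    ⟨max 1 (max C₁ C₂), le_max_left _ _, fun w hw ↦ (hF₁ w hw).2.trans (by simp),
      fun w hw ↦ (hG₁ w hw).2.trans (by simp)⟩
  -- Positivity of `K` allows the closed form of the Grönwall bound, which divides by `K`.
  obtain ⟨K, hK, hFK, hGK, hGK'⟩ : ∃ K : ℝ≥0, 0 < K ∧
      LipschitzOnWith K F (closedBall ((x₀, y₀), v₀) R) ∧
      LipschitzOnWith K G (closedBall ((x₀, y₀), v₀) R) ∧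
      LipschitzOnWith K (fderiv ℝ G) (closedBall ((x₀, y₀), v₀) R) :=
    ⟨max 1 (max K₁ K₂), by simp, hF₂.weaken (by simp), hG₂.weaken (by simp),
      hG₃.weaken (by simp)⟩
  have hmemO : ∀ w ∈ closedBall ((x₀, y₀), v₀) R, w ∈ O := fun w hw ↦ (hF₁ w hw).1
  clear h₁ h₂ hF₁ hF₂ hG₁ hG₂ hG₃
  have hC' : (1 : ℝ) ≤ C := hC
  have hC0 : (0 : ℝ) < C := by linarith
  set B := closedBall ((x₀, y₀), v₀) R with hB
  -- Budget of radii: the horizontal solution stays within `R / 4`, the vertical ones starting on it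
  -- within `R / 2`, and a further linear step of length at most `2 * ε` within `R`.
  obtain ⟨ε, hε, hεR, hCε⟩ : ∃ ε : ℝ, 0 < ε ∧ ε ≤ R ∧ C * ε ≤ R / 4 := by
    refine ⟨R / 4 / C, by positivity, ?_, le_of_eq (by field_simp)⟩
    rw [div_le_iff₀ hC0]; nlinarith
  have hmemB : ∀ {x y : ℝ} {v : E}, x ∈ Icc (x₀ - ε) (x₀ + ε) → y ∈ Icc (y₀ - ε) (y₀ + ε) →
      v ∈ closedBall v₀ R → ((x, y), v) ∈ B := by
    intro x y v hx hy hv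
    rw [hB, ← closedBall_prod_same, ← closedBall_prod_same, Real.closedBall_eq_Icc,
      Real.closedBall_eq_Icc]
    exact ⟨⟨⟨by linarith [hx.1], by linarith [hx.2]⟩, ⟨by linarith [hy.1], by linarith [hy.2]⟩⟩, hv⟩
  have hx₀ : x₀ ∈ Icc (x₀ - ε) (x₀ + ε) := ⟨by linarith, by linarith⟩
  have hy₀ : y₀ ∈ Icc (y₀ - ε) (y₀ + ε) := ⟨by linarith, by linarith⟩
  lift R to ℝ≥0 using hR.le
  have hsub : ∀ {r : ℝ}, r ≤ R → closedBall v₀ r ⊆ closedBall v₀ R := closedBall_subset_closedBall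
  have hcurve : ∀ {H : (ℝ × ℝ) × E → E} {ι : ℝ → ℝ × ℝ} {s : Set ℝ},
      LipschitzOnWith K H B → (∀ t τ, ‖ι τ - ι t‖ ≤ |τ - t|) → (∀ t ∈ s, ∀ v ∈ closedBall v₀ R,
      (ι t, v) ∈ B) → ∀ t ∈ s, ∀ τ ∈ s, ∀ u ∈ closedBall v₀ R, ∀ v ∈ closedBall v₀ R,
      ‖H (ι τ, u) - H (ι t, v)‖ ≤ K * max |τ - t| ‖u - v‖ := by
    intro H ι s hH hι hs t ht τ hτ u hu v hv
    refine (hH.norm_sub_le (hs τ hτ u hu) (hs t ht v hv)).trans ?_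
    gcongr
    exact max_le_max (hι t τ) le_rfl
  have hιx : ∀ y t τ : ℝ, ‖((τ, y) : ℝ × ℝ) - (t, y)‖ ≤ |τ - t| := fun y t τ ↦ by
    simp [Prod.norm_def]
  have hιy : ∀ x t τ : ℝ, ‖((x, τ) : ℝ × ℝ) - (x, t)‖ ≤ |τ - t| := fun y t τ ↦ by
    simp [Prod.norm_def]
  -- the solution along the horizontal line through the base point
  obtain ⟨α, hα₀, hα⟩ := exists_solution_mem_closedBall (f := fun x u ↦ F ((x, y₀), u))
    (t₀ := x₀) (x₀ := v₀) (x := v₀) (a := R / 4) (r := 0) (L := C) (K := K) hε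
    (fun t ht ↦ LipschitzOnWith.of_dist_le_mul fun u hu v hv ↦ by
      have := hcurve hFK (hιx y₀) (fun t ht v hv ↦ hmemB ht hy₀ hv) t ht t ht u
        (hsub (by simp; linarith) hu) v (hsub (by simp; linarith) hv)
      simpa [dist_eq_norm] using this)
    (fun u hu ↦ hFK.continuousOn.comp (by fun_prop)
      fun t ht ↦ hmemB ht hy₀ (hsub (by simp; linarith) hu))
    (fun t ht u hu ↦ hFC _ (hmemB ht hy₀ (hsub (by simp; linarith) hu)))
    (by simpa using hCε) (by simp)
  have hα' : ∀ x ∈ Icc (x₀ - ε) (x₀ + ε), α x ∈ closedBall v₀ R := fun x hx ↦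
    hsub (by simp; linarith) (hα x hx).1
  -- Vertical solutions are started on the horizontal one, so $v_y=G$ holds by construction, while
  -- $v_x=F$ is so far known only on $y=y_0$.
  have hβ : ∀ x ∈ Icc (x₀ - ε) (x₀ + ε), ∃ β : ℝ → E, β y₀ = α x ∧
      ∀ y ∈ Icc (y₀ - ε) (y₀ + ε), β y ∈ closedBall v₀ ((R / 2 : ℝ≥0) : ℝ) ∧
      HasDerivWithinAt β (G ((x, y), β y)) (Icc (y₀ - ε) (y₀ + ε)) y := by
    intro x hx
    refine exists_solution_mem_closedBall (f := fun y u ↦ G ((x, y), u))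
      (t₀ := y₀) (x₀ := v₀) (x := α x) (a := R / 2) (r := R / 4) (L := C) (K := K) hε
      (fun t ht ↦ LipschitzOnWith.of_dist_le_mul fun u hu v hv ↦ ?_)
      (fun u hu ↦ hGK.continuousOn.comp (by fun_prop)
        fun t ht ↦ hmemB hx ht (hsub (by simp) hu))
      (fun t ht u hu ↦ hGC _ (hmemB hx ht (hsub (by simp) hu)))
      (by simp; linarith) (hα x hx).1
    have := hcurve hGK (hιy x) (fun t ht v hv ↦ hmemB hx ht hv) t ht t ht u
      (hsub (by simp) hu) v (hsub (by simp) hv)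
    simpa [dist_eq_norm] using this
  choose! v hv₀ hv using hβ
  have hvR : ∀ x ∈ Icc (x₀ - ε) (x₀ + ε), ∀ y ∈ Icc (y₀ - ε) (y₀ + ε), v x y ∈ closedBall v₀ R :=
    fun x hx y hy ↦ hsub (by simp) (hv x hx y hy).1
  have hyest : ∀ x ∈ Icc (x₀ - ε) (x₀ + ε), ∀ y ∈ Icc (y₀ - ε) (y₀ + ε),
      ∀ y' ∈ Icc (y₀ - ε) (y₀ + ε),
      ‖v x y' - v x y - (y' - y) • G ((x, y), v x y)‖ ≤ K * C * (y' - y) ^ 2 := by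
    intro x hx y hy y' hy'
    exact norm_sub_sub_smul_le_of_lipschitz_velocity (convex_Icc _ _) hC' K.2
      (fun y hy ↦ (hv x hx y hy).2) (fun y hy ↦ hGC _ (hmemB hx hy (hvR x hx y hy)))
      (fun t ht τ hτ ↦ hcurve hGK (hιy x) (fun t ht v hv ↦ hmemB hx ht hv) t ht τ hτ _
        (hvR x hx τ hτ) _ (hvR x hx t ht)) hy hy'
  have hylip : ∀ x ∈ Icc (x₀ - ε) (x₀ + ε), ∀ y ∈ Icc (y₀ - ε) (y₀ + ε),
      ∀ y' ∈ Icc (y₀ - ε) (y₀ + ε), ‖v x y' - v x y‖ ≤ C * |y' - y| := by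
    intro x hx y hy y' hy'
    simpa using (convex_Icc _ _).norm_image_sub_le_of_norm_hasDerivWithin_le
      (fun y hy ↦ (hv x hx y hy).2) (fun y hy ↦ hGC _ (hmemB hx hy (hvR x hx y hy))) hy hy'
  -- The equation $v_x=F$ away from the initial line. The defect $v(x',\tau)-v(x,\tau)-(x'-x)F$ is
  -- $O((x'-x)^2)$ at $\tau=y_0$. By compatibility its $\tau$-derivative is bounded by $K$ times
  -- itself plus $O((x'-x)^2)$, so Grönwall propagates the quadratic bound.
  obtain ⟨M, hM, hxest⟩ : ∃ M : ℝ, 0 ≤ M ∧ ∀ x ∈ Icc (x₀ - ε) (x₀ + ε),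
      ∀ x' ∈ Icc (x₀ - ε) (x₀ + ε), ∀ y ∈ Icc (y₀ - ε) (y₀ + ε),
      ‖v x' y - v x y - (x' - x) • F ((x, y), v x y)‖ ≤ M * (x' - x) ^ 2 := by
    refine ⟨(K * C + C ^ 2) * Real.exp (K * ε), by positivity, fun x hx x' hx' y hy ↦ ?_⟩
    set w : ℝ → (ℝ × ℝ) × E := fun τ ↦ ((x, τ), v x τ) with hw
    have hwB : ∀ τ ∈ Icc (y₀ - ε) (y₀ + ε), w τ ∈ B := fun τ hτ ↦ hmemB hx hτ (hvR x hx τ hτ)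
    have hw' : ∀ τ ∈ Icc (y₀ - ε) (y₀ + ε),
        HasDerivWithinAt w ((0, 1), G (w τ)) (Icc (y₀ - ε) (y₀ + ε)) τ := fun τ hτ ↦
      ((hasDerivWithinAt_const _ _ _).prodMk (hasDerivWithinAt_id _ _)).prodMk (hv x hx τ hτ).2
    have hFd : ∀ w ∈ B, HasFDerivAt F (fderiv ℝ F w) w := fun w hw ↦
      ((hF.contDiffAt (hO.mem_nhds (hmemO w hw))).differentiableAt (by simp)).hasFDerivAt
    have hGd : ∀ w ∈ B, HasFDerivAt G (fderiv ℝ G w) w := fun w hw ↦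
      ((hG.contDiffAt (hO.mem_nhds (hmemO w hw))).differentiableAt (by simp)).hasFDerivAt
    have hs : |x' - x| ≤ 2 * ε := by
      rw [abs_le]; constructor <;> linarith [hx.1, hx.2, hx'.1, hx'.2]
    have hgr := norm_le_gronwallBound_of_mem_Icc
      (f := fun τ ↦ v x' τ - v x τ - (x' - x) • F (w τ))
      (f' := fun τ ↦ G ((x', τ), v x' τ) - G (w τ)
        - (x' - x) • fderiv ℝ G (w τ) ((1, 0), F (w τ)))
      (K := K) (δ := K * C * (x' - x) ^ 2) (η := K * (C ^ 2 * (x' - x) ^ 2))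
      (fun τ hτ ↦ ?_) ?_ (fun τ hτ ↦ ?_) hy
    · refine hgr.trans ?_
      have h1 : |y - y₀| ≤ ε := by rw [abs_le]; constructor <;> linarith [hy.1, hy.2]
      have hK' : (K : ℝ) ≠ 0 := by exact_mod_cast hK.ne'
      rw [gronwallBound_of_K_ne_0 hK']
      have h2 : Real.exp (K * |y - y₀|) ≤ Real.exp (K * ε) := by gcongr
      have h3 : (K : ℝ) * (C ^ 2 * (x' - x) ^ 2) / K = C ^ 2 * (x' - x) ^ 2 := by field_simp
      simp only [h3]
      calc _ ≤ K * C * (x' - x) ^ 2 * Real.exp (K * ε)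
            + C ^ 2 * (x' - x) ^ 2 * Real.exp (K * ε) := by gcongr; linarith
        _ = _ := by ring
    · refine ((hv x' hx' τ hτ).2.sub (hv x hx τ hτ).2).sub ?_
      have := ((hFd _ (hwB τ hτ)).comp_hasDerivWithinAt τ (hw' τ hτ)).const_smul (x' - x)
      -- Compatibility turns the derivative of $F$ along the vertical solution into that of $G$ in
      -- the direction `((1, 0), F w)`.
      rwa [hcomp _ (hmemO _ (hwB τ hτ))] at this
    · simp only [hw, hv₀ x hx, hv₀ x' hx']
      exact norm_sub_sub_smul_le_of_lipschitz_velocity (convex_Icc _ _) hC' K.2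
        (fun x hx ↦ (hα x hx).2) (fun x hx ↦ hFC _ (hmemB hx hy₀ (hα' x hx)))
        (fun t ht τ hτ ↦ hcurve hFK (hιx y₀) (fun t ht v hv ↦ hmemB ht hy₀ hv) t ht τ hτ _
          (hα' τ hτ) _ (hα' t ht)) hx hx'
    · have hFw : ‖F (w τ)‖ ≤ C := hFC _ (hwB τ hτ)
      -- The linearly predicted point. From the true point to it, $G$ changes by at most $K$ times
      -- the defect; from it to `w τ`, the Taylor remainder of $G$ is quadratic.
      have hw₁ : ((x', τ), v x τ + (x' - x) • F (w τ)) ∈ B := by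
        refine hmemB hx' hτ ?_
        have h1 : ‖v x τ - v₀‖ ≤ R / 2 := by
          simpa [dist_eq_norm] using (hv x hx τ hτ).1
        have h2 : ‖(x' - x) • F (w τ)‖ ≤ R / 2 := by
          rw [norm_smul, Real.norm_eq_abs]
          calc _ ≤ 2 * ε * C := by gcongr
            _ ≤ _ := by linarith
        rw [mem_closedBall, dist_eq_norm]
        calc _ = ‖(v x τ - v₀) + (x' - x) • F (w τ)‖ := by congr 1; abel
          _ ≤ _ := (norm_add_le _ _).trans (by linarith)
      have hdiff : ((x', τ), v x τ + (x' - x) • F (w τ)) - w τ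
          = (x' - x) • (((1, 0), F (w τ)) : (ℝ × ℝ) × E) := by simp [hw]
      have h1 := norm_sub_sub_fderiv_le (convex_closedBall _ _) hGd hGK' (hwB τ hτ) hw₁
      rw [hdiff, map_smul] at h1
      have h2 : ‖(x' - x) • (((1, 0), F (w τ)) : (ℝ × ℝ) × E)‖ ≤ C * |x' - x| := by
        rw [norm_smul, Real.norm_eq_abs, mul_comm]
        gcongr
        simp [Prod.norm_def, hFw, hC]
      have h3 := hGK.norm_sub_le (hmemB hx' hτ (hvR x' hx' τ hτ)) hw₁
      have h4 : ‖(((x', τ), v x' τ) : (ℝ × ℝ) × E) - ((x', τ), v x τ + (x' - x) • F (w τ))‖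
          = ‖v x' τ - v x τ - (x' - x) • F (w τ)‖ := by
        simp [Prod.norm_def, sub_sub]
      rw [h4] at h3
      calc _ = ‖(G ((x', τ), v x' τ) - G ((x', τ), v x τ + (x' - x) • F (w τ)))
            + (G ((x', τ), v x τ + (x' - x) • F (w τ)) - G (w τ)
              - (x' - x) • fderiv ℝ G (w τ) ((1, 0), F (w τ)))‖ := by congr 1; abel
        _ ≤ _ := norm_add_le _ _
        _ ≤ _ := add_le_add h3 (h1.trans ?_)
      gcongr
      calc _ ≤ (C * |x' - x|) ^ 2 := by gcongr
        _ = _ := by rw [mul_pow, sq_abs]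
  have hfd : ∀ z ∈ Ioo (x₀ - ε) (x₀ + ε) ×ˢ Ioo (y₀ - ε) (y₀ + ε),
      HasFDerivAt (fun z : ℝ × ℝ ↦ v z.1 z.2)
        ((ContinuousLinearMap.fst ℝ ℝ ℝ).smulRight (F (z, v z.1 z.2))
          + (ContinuousLinearMap.snd ℝ ℝ ℝ).smulRight (G (z, v z.1 z.2))) z := by
    rintro ⟨x, y⟩ hz
    have hx := Ioo_subset_Icc_self hz.1
    have hy := Ioo_subset_Icc_self hz.2
    refine HasFDerivAt.of_isLittleO (Asymptotics.IsBigO.trans_isLittleO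
      (g := fun z' ↦ ‖z' - (x, y)‖ ^ 2) ?_ (Asymptotics.isLittleO_pow_sub_sub _ one_lt_two))
    refine Asymptotics.IsBigO.of_bound (M + K * C + K * C) ?_
    filter_upwards [(isOpen_Ioo.prod isOpen_Ioo).mem_nhds hz] with ⟨x', y'⟩ hz'
    have hx' := Ioo_subset_Icc_self hz'.1
    have hy' := Ioo_subset_Icc_self hz'.2
    have h1 := hxest x hx x' hx' y' hy'
    have h2 := hyest x hx y hy y' hy'
    have h3 := hcurve hFK (hιy x) (fun t ht v hv ↦ hmemB hx ht hv) y hy y' hy' _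
        (hvR x hx y' hy') _ (hvR x hx y hy)
    have h4 : max |y' - y| ‖v x y' - v x y‖ ≤ C * |y' - y| :=
      max_le (le_mul_of_one_le_left (abs_nonneg _) hC') (hylip x hx y hy y' hy')
    have hs : |x' - x| ≤ ‖((x', y') : ℝ × ℝ) - (x, y)‖ := norm_fst_le (((x', y') : ℝ × ℝ) - (x, y))
    have ht : |y' - y| ≤ ‖((x', y') : ℝ × ℝ) - (x, y)‖ := norm_snd_le (((x', y') : ℝ × ℝ) - (x, y))
    set N := ‖((x', y') : ℝ × ℝ) - (x, y)‖ with hN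
    have hs2 : (x' - x) ^ 2 ≤ N ^ 2 := by rw [← sq_abs]; gcongr
    have ht2 : (y' - y) ^ 2 ≤ N ^ 2 := by rw [← sq_abs]; gcongr
    have h5 : ‖(x' - x) • (F ((x, y'), v x y') - F ((x, y), v x y))‖ ≤ K * C * N ^ 2 := by
      rw [norm_smul, Real.norm_eq_abs]
      calc _ ≤ N * (K * (C * N)) := by
            gcongr
            exact h3.trans (by gcongr; exact h4.trans (by gcongr))
        _ = _ := by ring
    rw [norm_pow, norm_norm]
    change ‖v x' y' - v x y - ((x' - x) • F ((x, y), v x y) + (y' - y) • G ((x, y), v x y))‖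
      ≤ (M + K * C + K * C) * N ^ 2
    -- The increment passes through the corner `(x, y')`; the middle term moves $F$ from that corner
    -- back to the base point.
    calc _ = ‖(v x' y' - v x y' - (x' - x) • F ((x, y'), v x y'))
          + (x' - x) • (F ((x, y'), v x y') - F ((x, y), v x y))
          + (v x y' - v x y - (y' - y) • G ((x, y), v x y))‖ := by congr 1; module
      _ ≤ M * N ^ 2 + K * C * N ^ 2 + K * C * N ^ 2 := by
          refine (norm_add₃_le).trans ?_
          gcongr
          · exact h1.trans (by gcongr)
          · exact h2.trans (by gcongr)
      _ = _ := by ring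
  have hV : IsOpen (Ioo (x₀ - ε) (x₀ + ε) ×ˢ Ioo (y₀ - ε) (y₀ + ε)) := isOpen_Ioo.prod isOpen_Ioo
  have hmem : ∀ z ∈ Ioo (x₀ - ε) (x₀ + ε) ×ˢ Ioo (y₀ - ε) (y₀ + ε), (z, v z.1 z.2) ∈ O :=
    fun z hz ↦ hmemO _ (hmemB (Ioo_subset_Icc_self hz.1) (Ioo_subset_Icc_self hz.2)
      (hvR _ (Ioo_subset_Icc_self hz.1) _ (Ioo_subset_Icc_self hz.2)))
  refine ⟨_, hV, ⟨⟨by linarith, by linarith⟩, ⟨by linarith, by linarith⟩⟩,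
    fun z ↦ v z.1 z.2, ?_, contDiffOn_of_total_differential hF hG hV hmem hfd,
    fun z hz ↦ ⟨hmem z hz, hfd z hz⟩⟩
  exact (hv₀ x₀ hx₀).trans hα₀

end TotalDifferential

/-! ### Partial derivatives of smooth functions and derivatives along graphs. -/

section Partial

variable {F H : ℝ × ℝ → ℝ} {U : Set (ℝ × ℝ)} {z : ℝ × ℝ}

theorem hasDerivAt_fst_section {F' : ℝ × ℝ →L[ℝ] ℝ} (h : HasFDerivAt F F' z) :
    HasDerivAt (fun s ↦ F (s, z.2)) (F' (1, 0)) z.1 :=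
  HasFDerivAt.comp_hasDerivAt (f := fun s ↦ (s, z.2)) z.1 h
    ((hasDerivAt_id z.1).prodMk (hasDerivAt_const z.1 z.2))

theorem hasDerivAt_snd_section {F' : ℝ × ℝ →L[ℝ] ℝ} (h : HasFDerivAt F F' z) :
    HasDerivAt (fun s ↦ F (z.1, s)) (F' (0, 1)) z.2 :=
  HasFDerivAt.comp_hasDerivAt (f := fun s ↦ (z.1, s)) z.2 h
    ((hasDerivAt_const z.2 z.1).prodMk (hasDerivAt_id z.2))

theorem px_eq {F' : ℝ × ℝ →L[ℝ] ℝ} (h : HasFDerivAt F F' z) : px F z = F' (1, 0) :=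
  (hasDerivAt_fst_section h).deriv

theorem py_eq {F' : ℝ × ℝ →L[ℝ] ℝ} (h : HasFDerivAt F F' z) : py F z = F' (0, 1) :=
  (hasDerivAt_snd_section h).deriv

theorem px_congr (h : F =ᶠ[𝓝 z] H) : px F z = px H z := by
  have hc : Tendsto (fun s : ℝ ↦ (s, z.2)) (𝓝 z.1) (𝓝 z) := by
    exact Continuous.tendsto' (by fun_prop) _ _ rfl
  exact Filter.EventuallyEq.deriv_eq (hc.eventually h)

theorem py_congr (h : F =ᶠ[𝓝 z] H) : py F z = py H z := by
  have hc : Tendsto (fun s : ℝ ↦ (z.1, s)) (𝓝 z.2) (𝓝 z) := by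
    exact Continuous.tendsto' (by fun_prop) _ _ rfl
  exact Filter.EventuallyEq.deriv_eq (hc.eventually h)

theorem px_congr_of_eqOn (hU : IsOpen U) (h : EqOn F H U) (hz : z ∈ U) : px F z = px H z :=
  px_congr (h.eventuallyEq_of_mem (hU.mem_nhds hz))

theorem py_congr_of_eqOn (hU : IsOpen U) (h : EqOn F H U) (hz : z ∈ U) : py F z = py H z :=
  py_congr (h.eventuallyEq_of_mem (hU.mem_nhds hz))

theorem Smooth.mono {V : Set (ℝ × ℝ)} (hF : Smooth F U) (h : V ⊆ U) : Smooth F V :=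
  ContDiffOn.mono hF h

theorem Smooth.contDiffAt (hF : Smooth F U) (hU : IsOpen U) (hz : z ∈ U) : ContDiffAt ℝ ∞ F z :=
  ContDiffOn.contDiffAt hF (hU.mem_nhds hz)

theorem Smooth.differentiableAt (hF : Smooth F U) (hU : IsOpen U) (hz : z ∈ U) :
    DifferentiableAt ℝ F z :=
  (hF.contDiffAt hU hz).differentiableAt (by simp)

theorem Smooth.px_eq_fderiv (hF : Smooth F U) (hU : IsOpen U) (hz : z ∈ U) :
    px F z = fderiv ℝ F z (1, 0) :=
  CondLin.px_eq (hF.differentiableAt hU hz).hasFDerivAt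

theorem Smooth.py_eq_fderiv (hF : Smooth F U) (hU : IsOpen U) (hz : z ∈ U) :
    py F z = fderiv ℝ F z (0, 1) :=
  CondLin.py_eq (hF.differentiableAt hU hz).hasFDerivAt

theorem Smooth.px (hF : Smooth F U) (hU : IsOpen U) : Smooth (px F) U :=
  ContDiffOn.congr ((((contDiffOn_infty_iff_fderiv_of_isOpen hU).1 hF).2).clm_apply contDiffOn_const)
    fun _ hz ↦ hF.px_eq_fderiv hU hz

theorem Smooth.py (hF : Smooth F U) (hU : IsOpen U) : Smooth (py F) U :=
  ContDiffOn.congr ((((contDiffOn_infty_iff_fderiv_of_isOpen hU).1 hF).2).clm_apply contDiffOn_const)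
    fun _ hz ↦ hF.py_eq_fderiv hU hz

theorem Smooth.add (hF : Smooth F U) (hH : Smooth H U) : Smooth (fun w ↦ F w + H w) U :=
  ContDiffOn.add hF hH

theorem Smooth.sub (hF : Smooth F U) (hH : Smooth H U) : Smooth (fun w ↦ F w - H w) U :=
  ContDiffOn.sub hF hH

theorem Smooth.mul (hF : Smooth F U) (hH : Smooth H U) : Smooth (fun w ↦ F w * H w) U :=
  ContDiffOn.mul hF hH

theorem Smooth.const_mul (hF : Smooth F U) (k : ℝ) : Smooth (fun w ↦ k * F w) U :=
  contDiffOn_const.mul hF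

theorem Smooth.hasFDerivAt (hF : Smooth F U) (hU : IsOpen U) (hz : z ∈ U) :
    HasFDerivAt F ((ContinuousLinearMap.fst ℝ ℝ ℝ).smulRight (CondLin.px F z)
      + (ContinuousLinearMap.snd ℝ ℝ ℝ).smulRight (CondLin.py F z)) z := by
  convert (hF.differentiableAt hU hz).hasFDerivAt using 1
  rw [hF.px_eq_fderiv hU hz, hF.py_eq_fderiv hU hz]
  ext <;> simp

/-- The mixed partial derivatives of a smooth function agree. -/
theorem Smooth.px_py (hF : Smooth F U) (hU : IsOpen U) (hz : z ∈ U) :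
    CondLin.px (CondLin.py F) z = CondLin.py (CondLin.px F) z := by
  have hd : DifferentiableAt ℝ (fderiv ℝ F) z :=
    ((hF.contDiffAt hU hz).fderiv_right (m := 1) (by norm_cast)).differentiableAt (by simp)
  have hsymm : IsSymmSndFDerivAt ℝ F z :=
    (hF.contDiffAt hU hz).isSymmSndFDerivAt (by simpa using (mod_cast le_top : ((2 : ℕ∞) : ℕ∞ω) ≤ ∞))
  have h : ∀ v : ℝ × ℝ, HasFDerivAt (fun w ↦ fderiv ℝ F w v)
      ((fderiv ℝ (fderiv ℝ F) z).flip v) z := fun v ↦ by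
    simpa using hd.hasFDerivAt.clm_apply (hasFDerivAt_const v z)
  rw [px_congr_of_eqOn hU (fun w hw ↦ hF.py_eq_fderiv hU hw) hz,
    py_congr_of_eqOn hU (fun w hw ↦ hF.px_eq_fderiv hU hw) hz, CondLin.px_eq (h (0, 1)),
    CondLin.py_eq (h (1, 0))]
  exact hsymm.eq _ _

theorem px_add (hF : DifferentiableAt ℝ F z) (hH : DifferentiableAt ℝ H z) :
    px (fun w ↦ F w + H w) z = px F z + px H z := by
  have h : HasFDerivAt (fun w ↦ F w + H w) _ z := hF.hasFDerivAt.add hH.hasFDerivAt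
  rw [px_eq h, px_eq hF.hasFDerivAt, px_eq hH.hasFDerivAt]; rfl

theorem py_add (hF : DifferentiableAt ℝ F z) (hH : DifferentiableAt ℝ H z) :
    py (fun w ↦ F w + H w) z = py F z + py H z := by
  have h : HasFDerivAt (fun w ↦ F w + H w) _ z := hF.hasFDerivAt.add hH.hasFDerivAt
  rw [py_eq h, py_eq hF.hasFDerivAt, py_eq hH.hasFDerivAt]; rfl

theorem px_mul (hF : DifferentiableAt ℝ F z) (hH : DifferentiableAt ℝ H z) :
    px (fun w ↦ F w * H w) z = px F z * H z + F z * px H z := by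
  have h : HasFDerivAt (fun w ↦ F w * H w) _ z := hF.hasFDerivAt.mul hH.hasFDerivAt
  rw [px_eq h, px_eq hF.hasFDerivAt, px_eq hH.hasFDerivAt]
  simp; ring

theorem py_mul (hF : DifferentiableAt ℝ F z) (hH : DifferentiableAt ℝ H z) :
    py (fun w ↦ F w * H w) z = py F z * H z + F z * py H z := by
  have h : HasFDerivAt (fun w ↦ F w * H w) _ z := hF.hasFDerivAt.mul hH.hasFDerivAt
  rw [py_eq h, py_eq hF.hasFDerivAt, py_eq hH.hasFDerivAt]
  simp; ring

theorem px_const_mul (k : ℝ) (F : ℝ × ℝ → ℝ) (z : ℝ × ℝ) :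
    px (fun w ↦ k * F w) z = k * px F z :=
  deriv_const_mul_field ..

theorem py_const_mul (k : ℝ) (F : ℝ × ℝ → ℝ) (z : ℝ × ℝ) :
    py (fun w ↦ k * F w) z = k * py F z :=
  deriv_const_mul_field ..

/-- The total derivative along the graph of a function of one variable. -/
theorem Smooth.hasDerivAt_graph (hF : Smooth F U) (hU : IsOpen U) {y : ℝ → ℝ} {y' x : ℝ}
    (hy : HasDerivAt y y' x) (hx : (x, y x) ∈ U) :
    HasDerivAt (fun s ↦ F (s, y s)) (CondLin.px F (x, y x) + CondLin.py F (x, y x) * y') x := by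
  have h := HasFDerivAt.comp_hasDerivAt (f := fun s ↦ (s, y s)) x (hF.hasFDerivAt hU hx)
    ((hasDerivAt_id x).prodMk hy)
  simp only [add_apply, ContinuousLinearMap.smulRight_apply, ContinuousLinearMap.coe_fst',
    ContinuousLinearMap.coe_snd', smul_eq_mul] at h
  exact h.congr_deriv (by ring)

/-- The second total derivative along the graph of a function of one variable. -/
theorem Smooth.hasDerivAt_graph_deriv (hF : Smooth F U) (hU : IsOpen U) {y y₁ : ℝ → ℝ} {y₂ x : ℝ}
    (hy : HasDerivAt y (y₁ x) x) (hy₁ : HasDerivAt y₁ y₂ x) (hx : (x, y x) ∈ U) :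
    HasDerivAt (fun s ↦ CondLin.px F (s, y s) + CondLin.py F (s, y s) * y₁ s)
      (CondLin.px (CondLin.px F) (x, y x) + 2 * CondLin.py (CondLin.px F) (x, y x) * y₁ x
        + CondLin.py (CondLin.py F) (x, y x) * y₁ x ^ 2 + CondLin.py F (x, y x) * y₂) x := by
  refine (((hF.px hU).hasDerivAt_graph hU hy hx).add
    (((hF.py hU).hasDerivAt_graph hU hy hx).mul hy₁)).congr_deriv ?_
  rw [hF.px_py hU hx]
  ring

end Partial

/-! ### Iterated derivatives on open sets. -/

section OneVariable

variable {y : ℝ → ℝ} {I : Set ℝ} {x : ℝ}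

/-- On an open set the global iterated derivatives coincide with those within the set, so nothing is
needed of `y` outside `I`. -/
theorem hasDerivAt_iteratedDeriv_of_contDiffOn {n : ℕ} (hI : IsOpen I) (hy : ContDiffOn ℝ n y I)
    {k : ℕ} (hk : k < n) (hx : x ∈ I) :
    HasDerivAt (iteratedDeriv k y) (iteratedDeriv (k + 1) y x) x := by
  rw [iteratedDeriv_succ]
  have h := hy.differentiableOn_iteratedDerivWithin (m := k) (by exact_mod_cast hk) hI.uniqueDiffOn
  refine ((h.congr fun s hs ↦ ?_).differentiableAt (hI.mem_nhds hx)).hasDerivAt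
  exact (iteratedDerivWithin_of_isOpen hI hs).symm

end OneVariable

/-! ### The fourth-order equation as a consequence of the root equation. -/

/-- The coefficients of the second order equation are smooth on `U`. -/
structure Root.SmoothOn (R : Root) (U : Set (ℝ × ℝ)) : Prop where
  c : Smooth R.c U
  g : Smooth R.g U
  h : Smooth R.h U
  d : Smooth R.d U

/-- Only `d` is at issue: its denominator is $4cA_2=\tfrac43A_2^2$, which vanishes nowhere. -/
theorem FourthOrder.SmoothOn.root {Q : FourthOrder} {U : Set (ℝ × ℝ)} (hU : IsOpen U)
    (hQ : Q.SmoothOn U) (hA : ∀ z ∈ U, Q.A2 z ≠ 0) : Q.root.SmoothOn U := by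
  obtain ⟨hA0, hA1, hA2, -, -, -, -, hB4, -, -, -⟩ := hQ
  have hc : Smooth Q.c U := ContDiffOn.div_const hA2 3
  refine ⟨hc, ContDiffOn.div_const hA1 2, hA0, ?_⟩
  have hcx : ContDiffOn ℝ ∞ (px Q.c) U := hc.px hU
  have hcy : ContDiffOn ℝ ∞ (py Q.c) U := hc.py hU
  have hcxy : ContDiffOn ℝ ∞ (py (px Q.c)) U := (hc.px hU).py hU
  have hA0y : ContDiffOn ℝ ∞ (py Q.A0) U := hA0.py hU
  have hA1x : ContDiffOn ℝ ∞ (px Q.A1) U := hA1.px hU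
  have hA1y : ContDiffOn ℝ ∞ (py Q.A1) U := hA1.py hU
  have hA1yy : ContDiffOn ℝ ∞ (py (py Q.A1)) U := (hA1.py hU).py hU
  unfold Smooth at hc hA0 hA1 hA2 hB4
  refine ContDiffOn.div ?_ (by fun_prop) fun z hz ↦ ?_
  · fun_prop
  · have := hA z hz
    simp [FourthOrder.c, this]

section Arises

variable {R : Root} {U : Set (ℝ × ℝ)} {I : Set ℝ} {y : ℝ → ℝ}

/-- The first derivative of the root expression along `y`. -/
noncomputable def Root.derivLhs (R : Root) (y : ℝ → ℝ) (x : ℝ) : ℝ :=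
  iteratedDeriv 3 y x
    + ((px R.c (x, y x) + py R.c (x, y x) * deriv y x) * deriv y x ^ 3
      + R.c (x, y x) * (3 * deriv y x ^ 2 * iteratedDeriv 2 y x))
    - ((px R.g (x, y x) + py R.g (x, y x) * deriv y x) * deriv y x ^ 2
      + R.g (x, y x) * (2 * deriv y x * iteratedDeriv 2 y x))
    + ((px R.h (x, y x) + py R.h (x, y x) * deriv y x) * deriv y x
      + R.h (x, y x) * iteratedDeriv 2 y x)
    - (px R.d (x, y x) + py R.d (x, y x) * deriv y x)

/-- The second derivative of the root expression along `y`. -/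
noncomputable def Root.derivDerivLhs (R : Root) (y : ℝ → ℝ) (x : ℝ) : ℝ :=
  iteratedDeriv 4 y x
    + (px (px R.c) (x, y x) + 2 * py (px R.c) (x, y x) * deriv y x
        + py (py R.c) (x, y x) * deriv y x ^ 2 + py R.c (x, y x) * iteratedDeriv 2 y x)
        * deriv y x ^ 3
    + 6 * (px R.c (x, y x) + py R.c (x, y x) * deriv y x) * deriv y x ^ 2 * iteratedDeriv 2 y x
    + 6 * R.c (x, y x) * deriv y x * iteratedDeriv 2 y x ^ 2
    + 3 * R.c (x, y x) * deriv y x ^ 2 * iteratedDeriv 3 y x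
    - (px (px R.g) (x, y x) + 2 * py (px R.g) (x, y x) * deriv y x
        + py (py R.g) (x, y x) * deriv y x ^ 2 + py R.g (x, y x) * iteratedDeriv 2 y x)
        * deriv y x ^ 2
    - 4 * (px R.g (x, y x) + py R.g (x, y x) * deriv y x) * deriv y x * iteratedDeriv 2 y x
    - 2 * R.g (x, y x) * iteratedDeriv 2 y x ^ 2
    - 2 * R.g (x, y x) * deriv y x * iteratedDeriv 3 y x
    + (px (px R.h) (x, y x) + 2 * py (px R.h) (x, y x) * deriv y x
        + py (py R.h) (x, y x) * deriv y x ^ 2 + py R.h (x, y x) * iteratedDeriv 2 y x)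
        * deriv y x
    + 2 * (px R.h (x, y x) + py R.h (x, y x) * deriv y x) * iteratedDeriv 2 y x
    + R.h (x, y x) * iteratedDeriv 3 y x
    - (px (px R.d) (x, y x) + 2 * py (px R.d) (x, y x) * deriv y x
        + py (py R.d) (x, y x) * deriv y x ^ 2 + py R.d (x, y x) * iteratedDeriv 2 y x)

/-- The product and chain rules are applied twice. The first-derivative formula is needed on all of
`I`, the second only at `x`. -/
theorem Root.iteratedDeriv_two_lhs (hR : R.SmoothOn U) (hU : IsOpen U) (hI : IsOpen I)
    (hy : ContDiffOn ℝ 4 y I) (hg : GraphIn y I U) {x : ℝ} (hx : x ∈ I) :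
    iteratedDeriv 2 (R.lhs y) x = R.derivDerivLhs y x := by
  have h0 : ∀ s ∈ I, HasDerivAt y (deriv y s) s := fun s hs ↦ by
    simpa using hasDerivAt_iteratedDeriv_of_contDiffOn (n := 4) (k := 0) hI hy (by simp) hs
  have h1 : ∀ s ∈ I, HasDerivAt (deriv y) (iteratedDeriv 2 y s) s := fun s hs ↦ by
    simpa using hasDerivAt_iteratedDeriv_of_contDiffOn (n := 4) (k := 1) hI hy (by simp) hs
  have h2 : ∀ s ∈ I, HasDerivAt (iteratedDeriv 2 y) (iteratedDeriv 3 y s) s := fun s hs ↦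
    hasDerivAt_iteratedDeriv_of_contDiffOn (n := 4) (k := 2) hI hy (by simp) hs
  have h3 : ∀ s ∈ I, HasDerivAt (iteratedDeriv 3 y) (iteratedDeriv 4 y s) s := fun s hs ↦
    hasDerivAt_iteratedDeriv_of_contDiffOn (n := 4) (k := 3) hI hy (by simp) hs
  have hd : ∀ s ∈ I, HasDerivAt (R.lhs y) (R.derivLhs y s) s := fun s hs ↦ by
    refine (((((h2 s hs).add ((hR.c.hasDerivAt_graph hU (h0 s hs) (hg s hs)).mul
      ((h1 s hs).pow 3))).sub ((hR.g.hasDerivAt_graph hU (h0 s hs) (hg s hs)).mul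
      ((h1 s hs).pow 2))).add ((hR.h.hasDerivAt_graph hU (h0 s hs) (hg s hs)).mul
      (h1 s hs))).sub (hR.d.hasDerivAt_graph hU (h0 s hs) (hg s hs))).congr_deriv ?_
    simp only [Root.derivLhs, Pi.pow_apply]
    push_cast
    ring
  have hdd : HasDerivAt (R.derivLhs y) (R.derivDerivLhs y x) x := by
    have e0 := h0 x hx
    have e1 := h1 x hx
    have e2 := h2 x hx
    have ec := hR.c.hasDerivAt_graph hU e0 (hg x hx)
    have eg := hR.g.hasDerivAt_graph hU e0 (hg x hx)
    have eh := hR.h.hasDerivAt_graph hU e0 (hg x hx)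
    have ec' := hR.c.hasDerivAt_graph_deriv hU e0 e1 (hg x hx)
    have eg' := hR.g.hasDerivAt_graph_deriv hU e0 e1 (hg x hx)
    have eh' := hR.h.hasDerivAt_graph_deriv hU e0 e1 (hg x hx)
    have ed' := hR.d.hasDerivAt_graph_deriv hU e0 e1 (hg x hx)
    refine ((((((h3 x hx).add ((ec'.mul (e1.pow 3)).add (ec.mul
      (((e1.pow 2).const_mul 3).mul e2)))).sub ((eg'.mul (e1.pow 2)).add (eg.mul
      ((e1.const_mul 2).mul e2)))).add ((eh'.mul e1).add (eh.mul e2))).sub ed')).congr_deriv ?_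
    simp only [Root.derivDerivLhs, Pi.pow_apply, Pi.mul_apply]
    push_cast
    ring
  rw [iteratedDeriv_succ, iteratedDeriv_one]
  have : deriv (R.lhs y) =ᶠ[𝓝 x] R.derivLhs y := by
    filter_upwards [hI.mem_nhds hx] with s hs using (hd s hs).deriv
  rw [this.deriv_eq, hdd.deriv]

/-- After $y''$ is eliminated, both sides are polynomials in $y'$, $y'''$, $y''''$. The terms in
$y'''$ match because $3c=A_2$, $2g=A_1$, $h=A_0$, and the powers of $y'$ match by the constraints.
The third and fourth derivatives are never eliminated, which is why the root equation at the single
point `x` suffices. -/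
theorem FourthOrder.Constraints.lhs_eq {Q : FourthOrder} (hcon : Q.Constraints U)
    (hA : ∀ z ∈ U, Q.A2 z ≠ 0) {x : ℝ} (hx : (x, y x) ∈ U) (h : Q.root.lhs y x = 0) :
    Q.lhs y x = Q.root.derivDerivLhs y x := by
  have hgx : px Q.root.g = fun z ↦ 1 / 2 * px Q.A1 z := by
    funext z; rw [← px_const_mul]; congr 1; funext w; simp only [FourthOrder.root]; ring
  have hgy : py Q.root.g = fun z ↦ 1 / 2 * py Q.A1 z := by
    funext z; rw [← py_const_mul]; congr 1; funext w; simp only [FourthOrder.root]; ring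
  have hA2 : Q.A2 (x, y x) = 3 * Q.c (x, y x) := by simp only [FourthOrder.c]; ring
  have hc : Q.c (x, y x) ≠ 0 := fun h0 ↦ hA _ hx (by rw [hA2, h0, mul_zero])
  set z := (x, y x) with hz
  -- Clearing the denominator of `d` supplies the constraint on $B_4$.
  have hB4 : Q.B4 z = Q.d z * (4 * Q.c z * Q.A2 z) + 8 * Q.c z * Q.A1 z * Q.A0 z + Q.A1 z ^ 3 / 4
      - 3 * Q.A1 z * px Q.c z + 7 * Q.A0 z * py Q.c z - 2 * Q.c z * px Q.A1 z
      + 5 / 4 * Q.A1 z * py Q.A1 z + 3 * Q.c z * py Q.A0 z - 2 * py (px Q.c) z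
      + py (py Q.A1) z / 2 := by
    have : 4 * Q.c z * Q.A2 z ≠ 0 := by simp [hc, hA z hx]
    rw [FourthOrder.d, div_mul_cancel₀ _ this]
    ring
  have hy2 : iteratedDeriv 2 y x = -(Q.c z * deriv y x ^ 3) + Q.A1 z / 2 * deriv y x ^ 2
      - Q.A0 z * deriv y x + Q.d z := by
    simp only [Root.lhs, FourthOrder.root] at h
    linarith
  simp only [FourthOrder.lhs, Root.derivDerivLhs, hgx, hgy, px_const_mul, py_const_mul]
  simp only [FourthOrder.root, ← hz, hy2, hB4, hcon.b7 z hx, hcon.b6 z hx, hcon.b5 z hx,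
    hcon.b3 z hx, hcon.b2 z hx, hcon.b1 z hx, hcon.b0 z hx, hA2]
  ring

theorem FourthOrder.Constraints.arisesFrom {Q : FourthOrder} (hcon : Q.Constraints U)
    (hU : IsOpen U) (hQ : Q.SmoothOn U) (hA : ∀ z ∈ U, Q.A2 z ≠ 0) : Q.ArisesFrom Q.root U := by
  intro I y hI hy hg x hx h
  rw [Root.iteratedDeriv_two_lhs (hQ.root hU hA) hU hI hy hg hx, hcon.lhs_eq hA (hg x hx) h]

/-- Bootstrapping: the equation expresses $y''$ smoothly through $x,y,y'$, so $y''$ is as regular as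
$y'$. The case `n = 0` is excluded because $y'$ must be differentiable. -/
theorem contDiffOn_succ_of_lhs_eq_zero (hR : R.SmoothOn U) (hI : IsOpen I) {n : ℕ}
    (hn : n ≠ 0) (hy : ContDiffOn ℝ (n + 1) y I) (hg : GraphIn y I U) (h : ∀ x ∈ I, R.lhs y x = 0) :
    ContDiffOn ℝ (n + 1 + 1) y I := by
  have hyn : ContDiffOn ℝ n y I := hy.of_le (by exact_mod_cast Nat.le_succ n)
  obtain ⟨hd, -, hy'⟩ := (contDiffOn_succ_iff_deriv_of_isOpen hI).1 hy
  have hcoef : ∀ {F : ℝ × ℝ → ℝ}, Smooth F U → ContDiffOn ℝ n (fun x ↦ F (x, y x)) I := fun hF ↦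
    (ContDiffOn.of_le hF (by exact_mod_cast le_top)).comp (contDiffOn_id.prodMk hyn) hg
  have hy'' : ContDiffOn ℝ (n + 1) (deriv y) I := by
    have hc := hcoef hR.c
    have hgc := hcoef hR.g
    have hh := hcoef hR.h
    have hdc := hcoef hR.d
    have hyd : DifferentiableOn ℝ (deriv y) I := hy'.differentiableOn (by exact_mod_cast hn)
    refine (contDiffOn_succ_iff_deriv_of_isOpen hI).2 ⟨hyd, by simp, ?_⟩
    refine ContDiffOn.congr (f := fun x ↦ R.d (x, y x) - R.h (x, y x) * deriv y x
      + R.g (x, y x) * deriv y x ^ 2 - R.c (x, y x) * deriv y x ^ 3) (by fun_prop) fun x hx ↦ ?_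
    have := h x hx
    rw [Root.lhs, iteratedDeriv_succ, iteratedDeriv_one] at this
    linarith
  exact (contDiffOn_succ_iff_deriv_of_isOpen hI).2 ⟨hd, by simp, hy''⟩

theorem Root.IsSolution.contDiffOn_four (hR : R.SmoothOn U) (hI : IsOpen I)
    (h : R.IsSolution U I y) : ContDiffOn ℝ 4 y I := by
  have h3 := contDiffOn_succ_of_lhs_eq_zero (n := 1) hR hI one_ne_zero (by simpa [one_add_one_eq_two] using h.1)
    h.2.1 h.2.2
  have h4 := contDiffOn_succ_of_lhs_eq_zero (n := 2) hR hI two_ne_zero (by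
    convert h3 using 1; norm_num) h.2.1 h.2.2
  convert h4 using 1
  norm_num

theorem FourthOrder.Constraints.isSolution {Q : FourthOrder} (hcon : Q.Constraints U)
    (hU : IsOpen U) (hQ : Q.SmoothOn U) (hA : ∀ z ∈ U, Q.A2 z ≠ 0) (hI : IsOpen I)
    (h : Q.root.IsSolution U I y) : Q.IsSolution U I y := by
  have hy := h.contDiffOn_four (hQ.root hU hA) hI
  refine ⟨hy, h.2.1, fun x hx ↦ ?_⟩
  rw [hcon.arisesFrom hU hQ hA I y hI hy h.2.1 x hx (h.2.2 x hx), iteratedDeriv_succ,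
    iteratedDeriv_one]
  -- Here the root expression vanishes on the whole open set, so its second derivative is zero.
  have h0 : Q.root.lhs y =ᶠ[𝓝 x] fun _ ↦ 0 := by
    filter_upwards [hI.mem_nhds hx] with s hs using h.2.2 s hs
  rw [h0.deriv.deriv_eq]
  simp

end Arises

/-! ### Affine functions linearize the projected geodesic equation. -/

/-- `X` is an affine function on `V` for the connection whose Christoffel symbols are the negatives
of the coefficients of the geodesic system: its covariant Hessian vanishes. -/
structure Geometry.IsAffineOn (G : Geometry) (R : Root) (X : ℝ × ℝ → ℝ) (V : Set (ℝ × ℝ)) :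
    Prop where
  smooth : Smooth X V
  xx : ∀ z ∈ V, px (px X) z = -(G.a z * px X z + R.d z * py X z)
  xy : ∀ z ∈ V, py (px X) z = -(G.b z * px X z + G.e z * py X z)
  yy : ∀ z ∈ V, py (py X) z = -(R.c z * px X z + G.f z * py X z)

theorem Geometry.IsAffineOn.mono {G : Geometry} {R : Root} {X : ℝ × ℝ → ℝ} {V W : Set (ℝ × ℝ)}
    (h : G.IsAffineOn R X W) (hV : V ⊆ W) : G.IsAffineOn R X V :=
  ⟨h.smooth.mono hV, fun z hz ↦ h.xx z (hV hz), fun z hz ↦ h.xy z (hV hz),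
    fun z hz ↦ h.yy z (hV hz)⟩

/-- A function determined along a reparametrization by `φ` has derivative `ψ' / φ'`. -/
theorem hasDerivAt_of_comp_eq {u φ ψ : ℝ → ℝ} {φ' ψ' x : ℝ} (hφ : HasStrictDerivAt φ φ' x)
    (hφ' : φ' ≠ 0) (hψ : HasDerivAt ψ ψ' x) (hu : ∀ᶠ s in 𝓝 x, u (φ s) = ψ s) :
    HasDerivAt u (ψ' / φ') (φ x) := by
  have hf := hφ.hasStrictFDerivAt_equiv hφ'
  set e := hf.toOpenPartialHomeomorph φ with he
  have hx : x ∈ e.source := hf.mem_toOpenPartialHomeomorph_source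
  have hφx : φ x ∈ e.target := hf.image_mem_toOpenPartialHomeomorph_target
  have hg : HasDerivAt e.symm φ'⁻¹ (φ x) := (hφ.to_localInverse hφ').hasDerivAt
  have hgx : e.symm (φ x) = x := e.left_inv hx
  have hcomp : HasDerivAt (ψ ∘ e.symm) (ψ' * φ'⁻¹) (φ x) :=
    HasDerivAt.comp (φ x) (by rwa [hgx]) hg
  rw [div_eq_mul_inv]
  -- No regularity of `u` is assumed: near `φ x` it equals `ψ` composed with the local inverse of
  -- `φ`.
  refine hcomp.congr_of_eventuallyEq ?_
  have ht : Tendsto e.symm (𝓝 (φ x)) (𝓝 x) := by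
    simpa only [ContinuousAt, hgx] using hg.continuousAt
  filter_upwards [ht.eventually hu, e.open_target.mem_nhds hφx] with t h1 h2
  have h3 : φ (e.symm t) = t := e.right_inv h2
  rw [Function.comp_apply, ← h1, h3]

section Linearization

variable {G : Geometry} {R : Root} {X Y : ℝ × ℝ → ℝ} {V : Set (ℝ × ℝ)} {I : Set ℝ} {y : ℝ → ℝ}

/-- The derivative of `s ↦ F (s, y s)`. -/
noncomputable def graphVelocity (F : ℝ × ℝ → ℝ) (y : ℝ → ℝ) (x : ℝ) : ℝ :=
  px F (x, y x) + py F (x, y x) * deriv y x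

theorem Smooth.hasDerivAt_graphVelocity {F : ℝ × ℝ → ℝ} (hF : Smooth F V) (hV : IsOpen V)
    (hI : IsOpen I) (hy : ContDiffOn ℝ 2 y I) (hg : GraphIn y I V) {x : ℝ} (hx : x ∈ I) :
    HasDerivAt (fun s ↦ F (s, y s)) (graphVelocity F y x) x :=
  hF.hasDerivAt_graph hV
    (by simpa using hasDerivAt_iteratedDeriv_of_contDiffOn (n := 2) (k := 0) hI hy (by simp) hx)
    (hg x hx)

/-- Along any graph, an affine function satisfies a linear first order equation for its velocity,
with the root expression as the inhomogeneity. -/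
theorem Geometry.IsAffineOn.hasDerivAt_velocity (h : G.IsAffineOn R X V) (hV : IsOpen V)
    (hh : ∀ z ∈ V, R.h z = G.a z - 2 * G.e z) (hgg : ∀ z ∈ V, R.g z = G.f z - 2 * G.b z)
    (hI : IsOpen I) (hy : ContDiffOn ℝ 2 y I) (hg : GraphIn y I V) {x : ℝ} (hx : x ∈ I) :
    HasDerivAt (graphVelocity X y)
      (-(G.a (x, y x) + 2 * G.b (x, y x) * deriv y x + R.c (x, y x) * deriv y x ^ 2)
        * graphVelocity X y x + py X (x, y x) * R.lhs y x) x := by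
  have h0 : HasDerivAt y (deriv y x) x := by
    simpa using hasDerivAt_iteratedDeriv_of_contDiffOn (n := 2) (k := 0) hI hy (by simp) hx
  have h1 : HasDerivAt (deriv y) (iteratedDeriv 2 y x) x := by
    simpa using hasDerivAt_iteratedDeriv_of_contDiffOn (n := 2) (k := 1) hI hy (by simp) hx
  refine (h.smooth.hasDerivAt_graph_deriv hV h0 h1 (hg x hx)).congr_deriv ?_
  rw [h.xx _ (hg x hx), h.xy _ (hg x hx), h.yy _ (hg x hx)]
  -- Writing $X_x$ as the velocity minus $X_yy'$ collects the remaining terms into $X_yE[y]$, by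
  -- $h=a-2e$ and $g=f-2b$.
  simp only [Root.lhs, graphVelocity, hh _ (hg x hx), hgg _ (hg x hx)]
  ring

/-- With $\varphi,\psi$ the values of $X,Y$ along the graph,
$u_{tt}=(\psi''\varphi'-\psi'\varphi'')/\varphi'^3$. The common factor in the velocity equations
cancels, leaving $E[y]\,(Y_y\varphi'-X_y\psi')/\varphi'^3$, and that bracket is the Jacobian. -/
theorem Geometry.IsAffineOn.equiv (hX : G.IsAffineOn R X V) (hY : G.IsAffineOn R Y V)
    (hV : IsOpen V) (hh : ∀ z ∈ V, R.h z = G.a z - 2 * G.e z)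
    (hgg : ∀ z ∈ V, R.g z = G.f z - 2 * G.b z)
    (hjac : ∀ z ∈ V, px X z * py Y z - py X z * px Y z ≠ 0) {u : ℝ → ℝ} (hI : IsOpen I)
    (hy : ContDiffOn ℝ 2 y I) (hg : GraphIn y I V)
    (hne : ∀ x ∈ I, deriv (fun s ↦ X (s, y s)) x ≠ 0)
    (hu : ∀ x ∈ I, u (X (x, y x)) = Y (x, y x)) {x : ℝ} (hx : x ∈ I) :
    R.lhs y x = 0 ↔ iteratedDeriv 2 u (X (x, y x)) = 0 := by
  have hφ : ∀ s ∈ I, HasDerivAt (fun s ↦ X (s, y s)) (graphVelocity X y s) s := fun s hs ↦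
    hX.smooth.hasDerivAt_graphVelocity hV hI hy hg hs
  have hψ : ∀ s ∈ I, HasDerivAt (fun s ↦ Y (s, y s)) (graphVelocity Y y s) s := fun s hs ↦
    hY.smooth.hasDerivAt_graphVelocity hV hI hy hg hs
  have hφs : ∀ s ∈ I, HasStrictDerivAt (fun s ↦ X (s, y s)) (graphVelocity X y s) s :=
    fun s hs ↦ by
      have hgr : ContDiffOn ℝ 2 (fun s ↦ X (s, y s)) I :=
        (ContDiffOn.of_le hX.smooth (by simpa using (mod_cast le_top : ((2 : ℕ∞) : ℕ∞ω) ≤ ∞))).comp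
          (contDiffOn_id.prodMk hy) hg
      exact (hgr.contDiffAt (hI.mem_nhds hs)).hasStrictDerivAt' (hφ s hs) two_ne_zero
  have hne' : ∀ s ∈ I, graphVelocity X y s ≠ 0 := fun s hs ↦ by
    rw [← (hφ s hs).deriv]; exact hne s hs
  have hu1 : ∀ s ∈ I, deriv u (X (s, y s)) = graphVelocity Y y s / graphVelocity X y s :=
    fun s hs ↦ (hasDerivAt_of_comp_eq (hφs s hs) (hne' s hs) (hψ s hs)
      (by filter_upwards [hI.mem_nhds hs] with t ht using hu t ht)).deriv
  have hu2 := (hasDerivAt_of_comp_eq (hφs x hx) (hne' x hx)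
    ((hY.hasDerivAt_velocity hV hh hgg hI hy hg hx).div
      (hX.hasDerivAt_velocity hV hh hgg hI hy hg hx) (hne' x hx))
    (by filter_upwards [hI.mem_nhds hx] with t ht using hu1 t ht)).deriv
  have hJ : py Y (x, y x) * graphVelocity X y x - graphVelocity Y y x * py X (x, y x) ≠ 0 := by
    convert hjac _ (hg x hx) using 1
    simp only [graphVelocity]
    ring
  rw [iteratedDeriv_succ, iteratedDeriv_one, hu2, div_eq_zero_iff, div_eq_zero_iff]
  simp only [hne' x hx, or_false, pow_eq_zero_iff, ne_eq, OfNat.ofNat_ne_zero, not_false_eq_true]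
  constructor
  · intro h
    rw [h]
    ring
  · intro h
    refine (mul_eq_zero.1 (?_ : R.lhs y x *
      (py Y (x, y x) * graphVelocity X y x - graphVelocity Y y x * py X (x, y x)) = 0)).resolve_right hJ
    linear_combination h

/-- If the velocity of a plane curve is nowhere zero and parallel to the acceleration, then the
velocity has constant direction. -/
theorem exists_forall_linear_combination_eq {φ ψ φ₁ ψ₁ φ₂ ψ₂ : ℝ → ℝ} (hI : IsOpen I)
    (hc : IsPreconnected I) (hφ : ∀ x ∈ I, HasDerivAt φ (φ₁ x) x)
    (hψ : ∀ x ∈ I, HasDerivAt ψ (ψ₁ x) x) (hφ₁ : ∀ x ∈ I, HasDerivAt φ₁ (φ₂ x) x)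
    (hψ₁ : ∀ x ∈ I, HasDerivAt ψ₁ (ψ₂ x) x) (hne : ∀ x ∈ I, φ₁ x ≠ 0 ∨ ψ₁ x ≠ 0)
    (hpar : ∀ x ∈ I, φ₁ x * ψ₂ x = ψ₁ x * φ₂ x) :
    ∃ k l m : ℝ, (k ≠ 0 ∨ l ≠ 0) ∧ ∀ x ∈ I, k * φ x + l * ψ x = m := by
  rcases I.eq_empty_or_nonempty with rfl | ⟨x₀, hx₀⟩
  · exact ⟨1, 0, 0, by simp⟩
  have hpos : ∀ x ∈ I, 0 < φ₁ x ^ 2 + ψ₁ x ^ 2 := fun x hx ↦ by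
    rcases hne x hx with h | h
    · have := sq_nonneg (ψ₁ x); positivity
    · have := sq_nonneg (φ₁ x); positivity
  -- The unit tangent is shown to be constant; a slope would not do, since either component of the
  -- velocity may vanish.
  set N : ℝ → ℝ := fun x ↦ √(φ₁ x ^ 2 + ψ₁ x ^ 2) with hN
  have hN0 : ∀ x ∈ I, N x ≠ 0 := fun x hx ↦ (Real.sqrt_pos.2 (hpos x hx)).ne'
  have hNsq : ∀ x ∈ I, N x ^ 2 = φ₁ x ^ 2 + ψ₁ x ^ 2 := fun x hx ↦ Real.sq_sqrt (hpos x hx).le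
  have hN' : ∀ x ∈ I, HasDerivAt N ((φ₁ x * φ₂ x + ψ₁ x * ψ₂ x) / N x) x := fun x hx ↦ by
    refine ((((hφ₁ x hx).pow 2).add ((hψ₁ x hx).pow 2)).sqrt (hpos x hx).ne').congr_deriv ?_
    simp only [Pi.add_apply, Pi.pow_apply]
    change _ / (2 * N x) = _
    field_simp [hN0 x hx]
    norm_num
    ring
  have hconst : ∀ F : ℝ → ℝ, (∀ x ∈ I, HasDerivAt F 0 x) → ∀ x ∈ I, F x = F x₀ := fun F hF x hx ↦
    hI.is_const_of_deriv_eq_zero hc (fun s hs ↦ (hF s hs).differentiableAt.differentiableWithinAt)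
      (fun s hs ↦ (hF s hs).deriv) hx hx₀
  have hφN := hconst (fun x ↦ φ₁ x / N x) fun x hx ↦ by
    refine ((hφ₁ x hx).div (hN' x hx) (hN0 x hx)).congr_deriv ?_
    have := hN0 x hx
    field_simp
    rw [hNsq x hx]
    linear_combination -(ψ₁ x) * hpar x hx
  have hψN := hconst (fun x ↦ ψ₁ x / N x) fun x hx ↦ by
    refine ((hψ₁ x hx).div (hN' x hx) (hN0 x hx)).congr_deriv ?_
    have := hN0 x hx
    field_simp
    rw [hNsq x hx]
    linear_combination (φ₁ x) * hpar x hx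
  -- The coefficients form a normal to the velocity at `x₀`.
  have hline := hconst (fun x ↦ ψ₁ x₀ * φ x + -φ₁ x₀ * ψ x) fun x hx ↦ by
    refine (((hφ x hx).const_mul _).add ((hψ x hx).const_mul _)).congr_deriv ?_
    have h1 := hφN x hx
    have h2 := hψN x hx
    rw [div_eq_div_iff (hN0 x hx) (hN0 x₀ hx₀)] at h1 h2
    have : N x * N x₀ * (ψ₁ x₀ * φ₁ x + -φ₁ x₀ * ψ₁ x) = 0 := by
      linear_combination (ψ₁ x₀ * N x) * h1 - (φ₁ x₀ * N x) * h2
    simpa [hN0 x hx, hN0 x₀ hx₀] using this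
  exact ⟨ψ₁ x₀, -φ₁ x₀, _, by simpa using (hne x₀ hx₀).symm, hline⟩

/-- For a solution, velocity and acceleration of the image curve are parallel. Conversely,
differentiating the line equation twice gives $(kX_y+lY_y)E[y]=0$; were the first factor zero, then
together with $k\varphi'+l\psi'=0$ the nonzero Jacobian would force $k=l=0$. -/
theorem Geometry.IsAffineOn.lines (hX : G.IsAffineOn R X V) (hY : G.IsAffineOn R Y V)
    (hV : IsOpen V) (hh : ∀ z ∈ V, R.h z = G.a z - 2 * G.e z)
    (hgg : ∀ z ∈ V, R.g z = G.f z - 2 * G.b z)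
    (hjac : ∀ z ∈ V, px X z * py Y z - py X z * px Y z ≠ 0) (hI : IsOpen I)
    (hc : IsPreconnected I) (hy : ContDiffOn ℝ 2 y I) (hg : GraphIn y I V) :
    (∀ x ∈ I, R.lhs y x = 0) ↔
      ∃ k l m : ℝ, (k ≠ 0 ∨ l ≠ 0) ∧ ∀ x ∈ I, k * X (x, y x) + l * Y (x, y x) = m := by
  have hφ : ∀ s ∈ I, HasDerivAt (fun s ↦ X (s, y s)) (graphVelocity X y s) s := fun s hs ↦
    hX.smooth.hasDerivAt_graphVelocity hV hI hy hg hs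
  have hψ : ∀ s ∈ I, HasDerivAt (fun s ↦ Y (s, y s)) (graphVelocity Y y s) s := fun s hs ↦
    hY.smooth.hasDerivAt_graphVelocity hV hI hy hg hs
  have hφ₁ := fun s (hs : s ∈ I) ↦ hX.hasDerivAt_velocity hV hh hgg hI hy hg hs
  have hψ₁ := fun s (hs : s ∈ I) ↦ hY.hasDerivAt_velocity hV hh hgg hI hy hg hs
  have hJ : ∀ x ∈ I,
      graphVelocity X y x * py Y (x, y x) - graphVelocity Y y x * py X (x, y x) ≠ 0 := by
    intro x hx
    convert hjac _ (hg x hx) using 1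
    simp only [graphVelocity]
    ring
  constructor
  · intro h
    refine exists_forall_linear_combination_eq hI hc hφ hψ hφ₁ hψ₁ (fun x hx ↦ ?_) fun x hx ↦ ?_
    · by_contra! hcon
      exact hJ x hx (by rw [hcon.1, hcon.2]; ring)
    · rw [h x hx]
      ring
  · rintro ⟨k, l, m, hkl, hline⟩ x hx
    have h1 : ∀ s ∈ I, k * graphVelocity X y s + l * graphVelocity Y y s = 0 := fun s hs ↦ by
      have hd := ((hφ s hs).const_mul k).add ((hψ s hs).const_mul l)
      have hz : (fun s ↦ k * X (s, y s)) + (fun s ↦ l * Y (s, y s)) =ᶠ[𝓝 s] fun _ ↦ m := by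
        filter_upwards [hI.mem_nhds hs] with t ht using hline t ht
      rw [← hd.deriv, hz.deriv_eq, deriv_const]
    have h2 := ((hφ₁ x hx).const_mul k).add ((hψ₁ x hx).const_mul l)
    have hz : (fun s ↦ k * graphVelocity X y s) + (fun s ↦ l * graphVelocity Y y s)
        =ᶠ[𝓝 x] fun _ ↦ 0 := by
      filter_upwards [hI.mem_nhds hx] with t ht using h1 t ht
    have h3 := h2.deriv
    rw [hz.deriv_eq, deriv_const] at h3
    have h1x := h1 x hx
    have h4 : (k * py X (x, y x) + l * py Y (x, y x)) * R.lhs y x = 0 := by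
      linear_combination -h3 + (G.a (x, y x) + 2 * G.b (x, y x) * deriv y x
        + R.c (x, y x) * deriv y x ^ 2) * h1x
    refine (mul_eq_zero.1 h4).resolve_left fun h5 ↦ ?_
    rcases hkl with hk | hl
    · have : k * (graphVelocity X y x * py Y (x, y x) - graphVelocity Y y x * py X (x, y x))
          = 0 := by
        linear_combination py Y (x, y x) * h1x - graphVelocity Y y x * h5
      exact (mul_ne_zero hk (hJ x hx)) this
    · have : l * (graphVelocity X y x * py Y (x, y x) - graphVelocity Y y x * py X (x, y x))
          = 0 := by
        linear_combination -py X (x, y x) * h1x + graphVelocity X y x * h5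
      exact (mul_ne_zero hl (hJ x hx)) this

theorem Geometry.IsAffineOn.linearizedBy (hX : G.IsAffineOn R X V) (hY : G.IsAffineOn R Y V)
    (hV : IsOpen V) (hh : ∀ z ∈ V, R.h z = G.a z - 2 * G.e z)
    (hgg : ∀ z ∈ V, R.g z = G.f z - 2 * G.b z)
    (hjac : ∀ z ∈ V, px X z * py Y z - py X z * px Y z ≠ 0)
    (hinj : InjOn (fun z ↦ (X z, Y z)) V) : R.LinearizedBy X Y V where
  point := ⟨hX.smooth, hY.smooth, hinj, hjac⟩
  equiv _ _ _ hI hy hg hne hu _ hx := hX.equiv hY hV hh hgg hjac hI hy hg hne hu hx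
  lines _ _ hI hc hy hg := hX.lines hY hV hh hgg hjac hI hc hy hg

/-- The inverse function theorem in the plane: two smooth functions with nonzero Jacobian at a
point are jointly injective near it. -/
theorem exists_injOn_of_jacobian_ne_zero (hV : IsOpen V) (hX : Smooth X V) (hY : Smooth Y V)
    {z : ℝ × ℝ} (hz : z ∈ V) (hjac : px X z * py Y z - py X z * px Y z ≠ 0) :
    ∃ V' : Set (ℝ × ℝ), IsOpen V' ∧ z ∈ V' ∧ V' ⊆ V ∧ InjOn (fun z ↦ (X z, Y z)) V' := by
  set L := ((ContinuousLinearMap.fst ℝ ℝ ℝ).smulRight (px X z)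
      + (ContinuousLinearMap.snd ℝ ℝ ℝ).smulRight (py X z)).prod
      ((ContinuousLinearMap.fst ℝ ℝ ℝ).smulRight (px Y z)
      + (ContinuousLinearMap.snd ℝ ℝ ℝ).smulRight (py Y z)) with hL
  have hLinj : Function.Injective L := by
    rw [injective_iff_map_eq_zero]
    rintro ⟨s, t⟩ h
    have h1 : s * px X z + t * py X z = 0 := congrArg Prod.fst h
    have h2 : s * px Y z + t * py Y z = 0 := congrArg Prod.snd h
    have hs : (px X z * py Y z - py X z * px Y z) * s = 0 := by
      linear_combination py Y z * h1 - py X z * h2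
    have ht : (px X z * py Y z - py X z * px Y z) * t = 0 := by
      linear_combination px X z * h2 - px Y z * h1
    ext
    · exact (mul_eq_zero.1 hs).resolve_left hjac
    · exact (mul_eq_zero.1 ht).resolve_left hjac
  set e := (LinearEquiv.ofInjectiveEndo (L : ℝ × ℝ →ₗ[ℝ] ℝ × ℝ) hLinj).toContinuousLinearEquiv
    with he
  have heL : (e : ℝ × ℝ →L[ℝ] ℝ × ℝ) = L := by ext <;> rfl
  have hf : HasStrictFDerivAt (fun z ↦ (X z, Y z)) (e : ℝ × ℝ →L[ℝ] ℝ × ℝ) z := by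
    rw [heL]
    exact ((hX.contDiffAt hV hz).hasStrictFDerivAt' (hX.hasFDerivAt hV hz) (by simp)).prodMk
      ((hY.contDiffAt hV hz).hasStrictFDerivAt' (hY.hasFDerivAt hV hz) (by simp))
  refine ⟨V ∩ (hf.toOpenPartialHomeomorph _).source,
    hV.inter (hf.toOpenPartialHomeomorph _).open_source,
    ⟨hz, hf.mem_toOpenPartialHomeomorph_source⟩, inter_subset_left, ?_⟩
  exact (hf.toOpenPartialHomeomorph _).injOn.mono inter_subset_right

end Linearization

/-! ### Affine functions of a flat connection. -/

/-- The connection of the geodesic system on `W` is smooth, flat and has symmetric Ricci tensor. -/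
structure Geometry.IsFlatOn (G : Geometry) (R : Root) (W : Set (ℝ × ℝ)) : Prop where
  root : R.SmoothOn W
  a : Smooth G.a W
  b : Smooth G.b W
  e : Smooth G.e W
  f : Smooth G.f W
  flat1 : ∀ z ∈ W, py G.a z - px G.b z + G.b z * G.e z - R.c z * R.d z = 0
  flat2 : ∀ z ∈ W, py G.b z - px R.c z + (G.a z * R.c z - G.b z ^ 2)
    + (G.b z * G.f z - R.c z * G.e z) = 0
  flat3 : ∀ z ∈ W, py R.d z - px G.e z - (G.a z * G.e z - G.b z * R.d z)
    - (R.d z * G.f z - G.e z ^ 2) = 0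
  flat4 : ∀ z ∈ W, px G.b z + px G.f z = py G.a z + py G.e z

theorem Root.SmoothOn.mono {R : Root} {U W : Set (ℝ × ℝ)} (h : R.SmoothOn U) (hW : W ⊆ U) :
    R.SmoothOn W :=
  ⟨h.c.mono hW, h.g.mono hW, h.h.mono hW, h.d.mono hW⟩

theorem Geometry.Consistent.isFlatOn {G : Geometry} {R : Root} {W : Set (ℝ × ℝ)}
    (h : G.Consistent R W) (hW : IsOpen W) (hR : R.SmoothOn W) : G.IsFlatOn R W := by
  obtain ⟨ha, hb, he, hf, -, -, -⟩ := h.smooth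
  refine ⟨hR, ha, hb, he, hf, h.flat1, h.flat2, h.flat3, fun z hz ↦ ?_⟩
  rw [← px_add (hb.differentiableAt hW hz) (hf.differentiableAt hW hz),
    ← py_add (ha.differentiableAt hW hz) (he.differentiableAt hW hz)]
  exact h.flat4 z hz

/-- A smooth function of `z`, viewed as a function on a product. -/
theorem Smooth.hasFDerivAt_comp_fst {F : ℝ × ℝ → ℝ} {W : Set (ℝ × ℝ)} (hF : Smooth F W)
    (hW : IsOpen W) {E : Type*} [NormedAddCommGroup E] [NormedSpace ℝ E] {w : (ℝ × ℝ) × E}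
    (hw : w.1 ∈ W) :
    HasFDerivAt (fun p : (ℝ × ℝ) × E ↦ F p.1) (((ContinuousLinearMap.fst ℝ ℝ ℝ).smulRight
      (CondLin.px F w.1) + (ContinuousLinearMap.snd ℝ ℝ ℝ).smulRight (CondLin.py F w.1)).comp
      (ContinuousLinearMap.fst ℝ (ℝ × ℝ) E)) w :=
  (hF.hasFDerivAt hW hw).comp w hasFDerivAt_fst

theorem Smooth.contDiffOn_comp_fst {F : ℝ × ℝ → ℝ} {W : Set (ℝ × ℝ)} (hF : Smooth F W)
    {E : Type*} [NormedAddCommGroup E] [NormedSpace ℝ E] :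
    ContDiffOn ℝ ∞ (fun p : (ℝ × ℝ) × E ↦ F p.1) (W ×ˢ univ) :=
  ContDiffOn.comp hF contDiffOn_fst fun _ hp ↦ hp.1

/-- A flat symmetric connection has local affine functions with prescribed differential. -/
theorem Geometry.IsFlatOn.exists_isAffineOn {G : Geometry} {R : Root} {W : Set (ℝ × ℝ)}
    (h : G.IsFlatOn R W) (hW : IsOpen W) {z : ℝ × ℝ} (hz : z ∈ W) (α β : ℝ) :
    ∃ (V : Set (ℝ × ℝ)) (X : ℝ × ℝ → ℝ), IsOpen V ∧ z ∈ V ∧ V ⊆ W ∧ G.IsAffineOn R X V ∧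
      px X z = α ∧ py X z = β := by
  -- The unknown is $(X,X_x,X_y)$, which turns the vanishing of the covariant Hessian into a
  -- first-order system.
  set O : Set ((ℝ × ℝ) × (ℝ × ℝ × ℝ)) := W ×ˢ univ with hO
  set F₁ : (ℝ × ℝ) × (ℝ × ℝ × ℝ) → ℝ × ℝ × ℝ := fun p ↦
    (p.2.2.1, -(G.a p.1 * p.2.2.1 + R.d p.1 * p.2.2.2), -(G.b p.1 * p.2.2.1 + G.e p.1 * p.2.2.2))
    with hF₁
  set F₂ : (ℝ × ℝ) × (ℝ × ℝ × ℝ) → ℝ × ℝ × ℝ := fun p ↦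
    (p.2.2.2, -(G.b p.1 * p.2.2.1 + G.e p.1 * p.2.2.2), -(R.c p.1 * p.2.2.1 + G.f p.1 * p.2.2.2))
    with hF₂
  have ca := h.a.contDiffOn_comp_fst (E := ℝ × ℝ × ℝ)
  have cb := h.b.contDiffOn_comp_fst (E := ℝ × ℝ × ℝ)
  have cc := h.root.c.contDiffOn_comp_fst (E := ℝ × ℝ × ℝ)
  have cd := h.root.d.contDiffOn_comp_fst (E := ℝ × ℝ × ℝ)
  have ce := h.e.contDiffOn_comp_fst (E := ℝ × ℝ × ℝ)
  have cf := h.f.contDiffOn_comp_fst (E := ℝ × ℝ × ℝ)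
  have hcomp : ∀ w ∈ O, fderiv ℝ F₁ w ((0, 1), F₂ w) = fderiv ℝ F₂ w ((1, 0), F₁ w) := by
    intro w hw
    have ha := h.a.hasFDerivAt_comp_fst hW hw.1
    have hb := h.b.hasFDerivAt_comp_fst hW hw.1
    have hc := h.root.c.hasFDerivAt_comp_fst hW hw.1
    have hd := h.root.d.hasFDerivAt_comp_fst hW hw.1
    have he := h.e.hasFDerivAt_comp_fst hW hw.1
    have hf := h.f.hasFDerivAt_comp_fst hW hw.1
    have hs : HasFDerivAt (fun p : (ℝ × ℝ) × (ℝ × ℝ × ℝ) ↦ p.2.2.1) _ w :=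
      (hasFDerivAt_id (𝕜 := ℝ) w).snd.snd.fst
    have ht : HasFDerivAt (fun p : (ℝ × ℝ) × (ℝ × ℝ × ℝ) ↦ p.2.2.2) _ w :=
      (hasFDerivAt_id (𝕜 := ℝ) w).snd.snd.snd
    have h₁ : HasFDerivAt F₁ _ w := hs.prodMk
      (((ha.mul hs).add (hd.mul ht)).neg.prodMk ((hb.mul hs).add (he.mul ht)).neg)
    have h₂ : HasFDerivAt F₂ _ w := ht.prodMk
      (((hb.mul hs).add (he.mul ht)).neg.prodMk ((hc.mul hs).add (hf.mul ht)).neg)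
    have e1 := h.flat1 _ hw.1
    have e2 := h.flat2 _ hw.1
    have e3 := h.flat3 _ hw.1
    have e4 := h.flat4 _ hw.1
    rw [h₁.fderiv, h₂.fderiv]
    simp [hF₁, hF₂]
    -- The component for $X$ is compatible by symmetry of the connection; those for $X_x$ and $X_y$
    -- are the curvature equations.
    constructor
    · linear_combination (-w.2.2.1) * e1 - w.2.2.2 * e3
    · linear_combination (-w.2.2.1) * e2 + w.2.2.2 * (e1 + e4)
  obtain ⟨V, hV, hzV, v, hvz, hvs, hv⟩ := exists_solution_total_differential
    (hW.prod isOpen_univ) (F := F₁) (G := F₂) (by fun_prop) (by fun_prop) hcomp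
    (z₀ := z) (v₀ := (0, α, β)) ⟨hz, mem_univ _⟩
  have hVW : V ⊆ W := fun w hw ↦ (hv w hw).1.1
  have hx : ∀ w ∈ V, px (fun w ↦ (v w).1) w = (v w).2.1 := fun w hw ↦ by
    rw [px_eq (hv w hw).2.fst]; simp [hF₁]
  have hy : ∀ w ∈ V, py (fun w ↦ (v w).1) w = (v w).2.2 := fun w hw ↦ by
    rw [py_eq (hv w hw).2.fst]; simp [hF₂]
  refine ⟨V, fun w ↦ (v w).1, hV, hzV, hVW, ⟨contDiff_fst.comp_contDiffOn hvs, fun w hw ↦ ?_,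
    fun w hw ↦ ?_, fun w hw ↦ ?_⟩, by rw [hx z hzV, hvz], by rw [hy z hzV, hvz]⟩
  · rw [px_congr_of_eqOn hV hx hw, px_eq (hv w hw).2.snd.fst, hx w hw, hy w hw]; simp [hF₁]
  · rw [py_congr_of_eqOn hV hx hw, py_eq (hv w hw).2.snd.fst, hx w hw, hy w hw]; simp [hF₂]
  · rw [py_congr_of_eqOn hV hy hw, py_eq (hv w hw).2.snd.snd, hx w hw, hy w hw]; simp [hF₂]

/-! ### Parallel forms and Cartesian coordinates. -/

/-- The symmetric form `p dx² + 2 q dx dy + r dy²` is parallel on `V`. -/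
structure Geometry.IsParallelOn (G : Geometry) (R : Root) (p q r : ℝ × ℝ → ℝ) (V : Set (ℝ × ℝ)) :
    Prop where
  p_smooth : Smooth p V
  q_smooth : Smooth q V
  r_smooth : Smooth r V
  p_x : ∀ z ∈ V, px p z = -2 * (G.a z * p z + R.d z * q z)
  q_x : ∀ z ∈ V, px q z = -(G.b z * p z) - (G.a z + G.e z) * q z - R.d z * r z
  r_x : ∀ z ∈ V, px r z = -2 * (G.b z * q z + G.e z * r z)
  p_y : ∀ z ∈ V, py p z = -2 * (G.b z * p z + G.e z * q z)
  q_y : ∀ z ∈ V, py q z = -(R.c z * p z) - (G.b z + G.f z) * q z - G.e z * r z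
  r_y : ∀ z ∈ V, py r z = -2 * (R.c z * q z + G.f z * r z)

section Parallel

variable {G : Geometry} {R : Root} {V W : Set (ℝ × ℝ)} {X Y p q r p' q' r' : ℝ × ℝ → ℝ}

theorem Geometry.Consistent.isParallelOn (h : G.Consistent R W) :
    G.IsParallelOn R G.p G.q G.r W := by
  obtain ⟨-, -, -, -, hp, hq, hr⟩ := h.smooth
  exact ⟨hp, hq, hr, h.p_x, h.q_x, h.r_x, h.p_y, h.q_y, h.r_y⟩

theorem Geometry.IsParallelOn.mono (h : G.IsParallelOn R p q r W) (hV : V ⊆ W) :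
    G.IsParallelOn R p q r V :=
  ⟨h.p_smooth.mono hV, h.q_smooth.mono hV, h.r_smooth.mono hV, fun z hz ↦ h.p_x z (hV hz),
    fun z hz ↦ h.q_x z (hV hz), fun z hz ↦ h.r_x z (hV hz), fun z hz ↦ h.p_y z (hV hz),
    fun z hz ↦ h.q_y z (hV hz), fun z hz ↦ h.r_y z (hV hz)⟩

/-- Quadratic forms in the differentials of affine functions are parallel. -/
theorem Geometry.IsAffineOn.isParallelOn (hX : G.IsAffineOn R X V) (hY : G.IsAffineOn R Y V)
    (hV : IsOpen V) (s t : ℝ) :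
    G.IsParallelOn R (fun z ↦ s * (px X z * px X z) + t * (px Y z * px Y z))
      (fun z ↦ s * (px X z * py X z) + t * (px Y z * py Y z))
      (fun z ↦ s * (py X z * py X z) + t * (py Y z * py Y z)) V := by
  have sXx := hX.smooth.px hV
  have sXy := hX.smooth.py hV
  have sYx := hY.smooth.px hV
  have sYy := hY.smooth.py hV
  have key : ∀ {A B C D : ℝ × ℝ → ℝ}, Smooth A V → Smooth B V → Smooth C V → Smooth D V →
      ∀ z ∈ V, px (fun z ↦ s * (A z * B z) + t * (C z * D z)) z
        = s * (px A z * B z + A z * px B z) + t * (px C z * D z + C z * px D z) ∧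
      py (fun z ↦ s * (A z * B z) + t * (C z * D z)) z
        = s * (py A z * B z + A z * py B z) + t * (py C z * D z + C z * py D z) := by
    intro A B C D hA hB hC hD z hz
    have h1 := ((hA.mul hB).const_mul s).differentiableAt hV hz
    have h2 := ((hC.mul hD).const_mul t).differentiableAt hV hz
    have dA := hA.differentiableAt hV hz
    have dB := hB.differentiableAt hV hz
    have dC := hC.differentiableAt hV hz
    have dD := hD.differentiableAt hV hz
    rw [px_add h1 h2, py_add h1 h2, px_const_mul, px_const_mul, py_const_mul, py_const_mul,
      px_mul dA dB, px_mul dC dD, py_mul dA dB, py_mul dC dD]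
    exact ⟨rfl, rfl⟩
  refine ⟨((sXx.mul sXx).const_mul s).add ((sYx.mul sYx).const_mul t),
    ((sXx.mul sXy).const_mul s).add ((sYx.mul sYy).const_mul t),
    ((sXy.mul sXy).const_mul s).add ((sYy.mul sYy).const_mul t), ?_, ?_, ?_, ?_, ?_, ?_⟩ <;>
  intro z hz
  · rw [(key sXx sXx sYx sYx z hz).1, hX.xx z hz, hY.xx z hz]; ring
  · rw [(key sXx sXy sYx sYy z hz).1, hX.smooth.px_py hV hz, hY.smooth.px_py hV hz, hX.xx z hz,
      hY.xx z hz, hX.xy z hz, hY.xy z hz]; ring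
  · rw [(key sXy sXy sYy sYy z hz).1, hX.smooth.px_py hV hz, hY.smooth.px_py hV hz, hX.xy z hz,
      hY.xy z hz]; ring
  · rw [(key sXx sXx sYx sYx z hz).2, hX.xy z hz, hY.xy z hz]; ring
  · rw [(key sXx sXy sYx sYy z hz).2, hX.xy z hz, hY.xy z hz, hX.yy z hz, hY.yy z hz]; ring
  · rw [(key sXy sXy sYy sYy z hz).2, hX.yy z hz, hY.yy z hz]; ring

/-- A function on a convex set whose derivative is bounded by a multiple of the function vanishes
if it vanishes at a point. -/
theorem eq_zero_of_norm_fderiv_le {E E' : Type*} [NormedAddCommGroup E] [NormedSpace ℝ E]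
    [NormedAddCommGroup E'] [NormedSpace ℝ E'] {s : Set E'} (hs : Convex ℝ s) {D : E' → E}
    {D' : E' → E' →L[ℝ] E} {K : ℝ} (hD : ∀ z ∈ s, HasFDerivAt D (D' z) z)
    (hK : ∀ z ∈ s, ‖D' z‖ ≤ K * ‖D z‖) {z₀ : E'} (hz₀ : z₀ ∈ s) (h₀ : D z₀ = 0) :
    ∀ z ∈ s, D z = 0 := by
  intro z hz
  have hmem : ∀ t ∈ Icc (0 : ℝ) 1, z₀ + t • (z - z₀) ∈ s := fun t ht ↦
    hs.add_smul_sub_mem hz₀ hz ht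
  have hd : ∀ t ∈ Icc (0 : ℝ) 1, HasDerivAt (fun t : ℝ ↦ D (z₀ + t • (z - z₀)))
      (D' (z₀ + t • (z - z₀)) (z - z₀)) t := fun t ht ↦ by
    have h1 : HasDerivAt (fun t : ℝ ↦ z₀ + t • (z - z₀)) (z - z₀) t := by
      simpa using ((hasDerivAt_id t).smul_const (z - z₀)).const_add z₀
    exact (hD _ (hmem t ht)).comp_hasDerivAt t h1
  -- Restriction to the segment from `z₀` to `z` reduces the claim to a one-variable uniqueness
  -- statement.
  have := eq_zero_of_abs_deriv_le_mul_abs_self_of_eq_zero_right (a := 0) (b := 1)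
    (f := fun t : ℝ ↦ D (z₀ + t • (z - z₀)))
    (f' := fun t : ℝ ↦ D' (z₀ + t • (z - z₀)) (z - z₀)) (K := K * ‖z - z₀‖)
    (fun t ht ↦ (hd t ht).continuousAt.continuousWithinAt)
    (fun t ht ↦ (hd t ⟨ht.1, ht.2.le⟩).hasDerivWithinAt) (by simpa using h₀) (fun t ht ↦ ?_) 1
    (by simp)
  · simpa using this
  · refine ((D' _).le_opNorm _).trans ?_
    calc _ ≤ K * ‖D (z₀ + t • (z - z₀))‖ * ‖z - z₀‖ := by
          gcongr; exact hK _ (hmem t ⟨ht.1, ht.2.le⟩)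
      _ = _ := by ring

/-- A parallel symmetric form is determined near a point by its value there. -/
theorem Geometry.IsParallelOn.eqOn (h : G.IsParallelOn R p q r V)
    (h' : G.IsParallelOn R p' q' r' V) (hV : IsOpen V) (hc : Convex ℝ V) {A : ℝ}
    (hA : ∀ z ∈ V, |G.a z| ≤ A ∧ |G.b z| ≤ A ∧ |R.c z| ≤ A ∧ |R.d z| ≤ A ∧ |G.e z| ≤ A ∧
      |G.f z| ≤ A) {z₀ : ℝ × ℝ} (hz₀ : z₀ ∈ V) (hp : p z₀ = p' z₀) (hq : q z₀ = q' z₀)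
    (hr : r z₀ = r' z₀) : ∀ z ∈ V, p z = p' z ∧ q z = q' z ∧ r z = r' z := by
  have hd : ∀ {F F' : ℝ × ℝ → ℝ}, Smooth F V → Smooth F' V → ∀ z ∈ V,
      HasFDerivAt (fun w ↦ F w - F' w) ((ContinuousLinearMap.fst ℝ ℝ ℝ).smulRight
        (px F z - px F' z) + (ContinuousLinearMap.snd ℝ ℝ ℝ).smulRight (py F z - py F' z)) z := by
    intro F F' hF hF' z hz
    refine ((hF.hasFDerivAt hV hz).sub (hF'.hasFDerivAt hV hz)).congr_fderiv ?_
    ext <;> simp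
  have hbound : ∀ {A₁ A₂ : ℝ}, 0 ≤ A₁ → 0 ≤ A₂ → ∀ {k l : ℝ}, |k| ≤ A₁ → |l| ≤ A₂ →
      ‖(ContinuousLinearMap.fst ℝ ℝ ℝ).smulRight k + (ContinuousLinearMap.snd ℝ ℝ ℝ).smulRight l‖
        ≤ A₁ + A₂ := by
    intro A₁ A₂ h₁ h₂ k l hk hl
    refine ContinuousLinearMap.opNorm_le_bound _ (by positivity) fun v ↦ ?_
    have hv₁ := norm_fst_le v
    have hv₂ := norm_snd_le v
    rw [Real.norm_eq_abs] at hv₁ hv₂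
    change |v.1 * k + v.2 * l| ≤ _
    calc _ ≤ |v.1| * |k| + |v.2| * |l| := by
          rw [← abs_mul, ← abs_mul]; exact abs_add_le _ _
      _ ≤ ‖v‖ * A₁ + ‖v‖ * A₂ := by gcongr
      _ = _ := by ring
  have hterm : ∀ {α β γ P Q S N : ℝ}, |α| ≤ 2 * A → |β| ≤ 2 * A → |γ| ≤ 2 * A → |P| ≤ N →
      |Q| ≤ N → |S| ≤ N → |α * P + β * Q + γ * S| ≤ 6 * A * N := by
    intro α β γ P Q S N hα hβ hγ hP hQ hS
    have hA0 : 0 ≤ 2 * A := (abs_nonneg _).trans hα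
    calc _ ≤ |α * P| + |β * Q| + |γ * S| := abs_add_three _ _ _
      _ ≤ 2 * A * N + 2 * A * N + 2 * A * N := by
          simp only [abs_mul]
          gcongr
      _ = _ := by ring
  -- The difference of two parallel forms solves the same linear homogeneous system. Each partial
  -- derivative has three terms with coefficients at most `2 * A`, and there are two partial
  -- derivatives, hence `12 * A`.
  have hzero := eq_zero_of_norm_fderiv_le hc (D := fun z ↦ (p z - p' z, q z - q' z, r z - r' z))
    (K := 12 * A) (fun z hz ↦ (hd h.p_smooth h'.p_smooth z hz).prodMk
      ((hd h.q_smooth h'.q_smooth z hz).prodMk (hd h.r_smooth h'.r_smooth z hz)))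
    (fun z hz ↦ ?_) hz₀ (by simp [hp, hq, hr])
  · intro z hz
    have := hzero z hz
    simpa [sub_eq_zero] using this
  · set N := ‖(p z - p' z, q z - q' z, r z - r' z)‖ with hN
    have hP : |p z - p' z| ≤ N := norm_fst_le (p z - p' z, q z - q' z, r z - r' z)
    have hQS : ‖(q z - q' z, r z - r' z)‖ ≤ N := norm_snd_le (p z - p' z, q z - q' z, r z - r' z)
    have hQ : |q z - q' z| ≤ N := (norm_fst_le (q z - q' z, r z - r' z)).trans hQS
    have hS : |r z - r' z| ≤ N := (norm_snd_le (q z - q' z, r z - r' z)).trans hQS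
    obtain ⟨ha, hb, hc, hd, he, hf⟩ := hA z hz
    have hA0 : 0 ≤ A := (abs_nonneg _).trans ha
    have hN0 : 0 ≤ N := (abs_nonneg _).trans hP
    have h2 : ∀ {k : ℝ}, |k| ≤ A → |-(2 * k)| ≤ 2 * A := fun hk ↦ by
      rw [abs_neg, abs_mul, abs_two]; gcongr
    have h1 : ∀ {k : ℝ}, |k| ≤ A → |-k| ≤ 2 * A := fun hk ↦ by
      rw [abs_neg]; linarith
    have h11 : ∀ {k l : ℝ}, |k| ≤ A → |l| ≤ A → |-(k + l)| ≤ 2 * A := fun hk hl ↦ by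
      rw [abs_neg]; exact (abs_add_le _ _).trans (by linarith)
    have h0 : |(0 : ℝ)| ≤ 2 * A := by simpa using hA0
    have hsum : 12 * A * N = 6 * A * N + 6 * A * N := by ring
    have hpos : 0 ≤ 6 * A * N := by positivity
    change ‖ContinuousLinearMap.prod _ (ContinuousLinearMap.prod _ _)‖ ≤ 12 * A * N
    rw [ContinuousLinearMap.opNorm_prod, Prod.norm_mk, ContinuousLinearMap.opNorm_prod,
      Prod.norm_mk, hsum]
    refine max_le (hbound hpos hpos ?_ ?_) (max_le (hbound hpos hpos ?_ ?_)
      (hbound hpos hpos ?_ ?_))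
    · convert hterm (h2 ha) (h2 hd) h0 hP hQ hS using 2
      rw [h.p_x z hz, h'.p_x z hz]; ring
    · convert hterm (h2 hb) (h2 he) h0 hP hQ hS using 2
      rw [h.p_y z hz, h'.p_y z hz]; ring
    · convert hterm (h1 hb) (h11 ha he) (h1 hd) hP hQ hS using 2
      rw [h.q_x z hz, h'.q_x z hz]; ring
    · convert hterm (h1 hc) (h11 hb hf) (h1 he) hP hQ hS using 2
      rw [h.q_y z hz, h'.q_y z hz]; ring
    · convert hterm h0 (h2 hb) (h2 he) hP hQ hS using 2
      rw [h.r_x z hz, h'.r_x z hz]; ring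
    · convert hterm h0 (h2 hc) (h2 hf) hP hQ hS using 2
      rw [h.r_y z hz, h'.r_y z hz]; ring

/-- Sylvester's law for a binary quadratic form with a nonzero first coefficient. -/
theorem exists_signed_squares_of_ne_zero {p q r : ℝ} (hp : p ≠ 0) :
    ∃ s t : ℝ, (s = 1 ∨ s = -1) ∧ (t = 1 ∨ t = -1) ∧ ∃ α β γ δ : ℝ,
      p = s * α ^ 2 + t * γ ^ 2 ∧ q = s * (α * β) + t * (γ * δ) ∧ r = s * β ^ 2 + t * δ ^ 2 := by
  have hsign : ∀ k : ℝ, ∃ s : ℝ, (s = 1 ∨ s = -1) ∧ ∃ α : ℝ, k = s * α ^ 2 := by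
    intro k
    rcases le_total 0 k with hk | hk
    · exact ⟨1, .inl rfl, √k, by rw [Real.sq_sqrt hk, one_mul]⟩
    · exact ⟨-1, .inr rfl, √(-k), by rw [Real.sq_sqrt (by linarith)]; ring⟩
  obtain ⟨s, hs, α, hα⟩ := hsign p
  -- Completing the square: this is the coefficient of $dy^2$ left after subtracting $p\,(dx+\tfrac
  -- qp\,dy)^2$.
  obtain ⟨t, ht, δ, hδ⟩ := hsign (r - q ^ 2 / p)
  have hs0 : s ≠ 0 := by rintro rfl; simp at hs
  have hα0 : α ≠ 0 := by rintro rfl; simp at hα; exact hp hα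
  refine ⟨s, t, hs, ht, α, q / (s * α), 0, δ, by rw [hα]; ring, by field_simp; ring, ?_⟩
  rw [← hδ, hα]
  field_simp
  ring

/-- Sylvester's law for a binary quadratic form. -/
theorem exists_signed_squares (p q r : ℝ) :
    ∃ s t : ℝ, (s = 1 ∨ s = -1) ∧ (t = 1 ∨ t = -1) ∧ ∃ α β γ δ : ℝ,
      p = s * α ^ 2 + t * γ ^ 2 ∧ q = s * (α * β) + t * (γ * δ) ∧ r = s * β ^ 2 + t * δ ^ 2 := by
  by_cases hp : p = 0
  · by_cases hr : r = 0
    -- $2q\,dx\,dy=(dx+\tfrac q2dy)^2-(dx-\tfrac q2dy)^2$.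
    · exact ⟨1, -1, .inl rfl, .inr rfl, 1, q / 2, 1, -q / 2, by rw [hp]; ring, by ring,
        by rw [hr]; ring⟩
    · obtain ⟨s, t, hs, ht, α, β, γ, δ, h1, h2, h3⟩ := exists_signed_squares_of_ne_zero
        (q := q) (r := p) hr
      exact ⟨s, t, hs, ht, β, α, δ, γ, h3, by rw [h2]; ring, h1⟩
  · exact exists_signed_squares_of_ne_zero hp

/-- Cartesian coordinates of a flat metric exist locally and linearize the projected equation. -/
theorem Geometry.Consistent.exists_isCartesian (h : G.Consistent R W) (hW : IsOpen W)
    (hR : R.SmoothOn W) {z : ℝ × ℝ} (hz : z ∈ W) :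
    ∃ (V : Set (ℝ × ℝ)) (X Y : ℝ × ℝ → ℝ), IsOpen V ∧ z ∈ V ∧ V ⊆ W ∧ G.IsCartesian X Y V ∧
      R.LinearizedBy X Y V := by
  have hflat := h.isFlatOn hW hR
  -- The diagonalization at `z` fixes the signs and the differentials that `X` and `Y` must have
  -- there.
  obtain ⟨s, t, hs, ht, α, β, γ, δ, hp, hq, hr⟩ := exists_signed_squares (G.p z) (G.q z) (G.r z)
  obtain ⟨V₁, X, hV₁, hz₁, hVW₁, hX, hXx, hXy⟩ := hflat.exists_isAffineOn hW hz α β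
  obtain ⟨V₂, Y, hV₂, hz₂, hVW₂, hY, hYx, hYy⟩ := hflat.exists_isAffineOn hW hz γ δ
  have hbd : ∀ {F : ℝ × ℝ → ℝ}, Smooth F W → ∀ᶠ A in atTop, ∀ᶠ w in 𝓝 z, |F w| ≤ A := by
    intro F hF
    filter_upwards [eventually_gt_atTop |F z|] with A hA
    filter_upwards [((hF.contDiffAt hW hz).continuousAt.abs).eventually_lt_const hA] with w hw
      using hw.le
  obtain ⟨A, ha, hb, hc, hd, he, hf⟩ := ((hbd hflat.a).and ((hbd hflat.b).and ((hbd hR.c).and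
    ((hbd hR.d).and ((hbd hflat.e).and (hbd hflat.f)))))).exists
  obtain ⟨ρ, hρ, hball⟩ := Metric.eventually_nhds_iff_ball.1
    ((ha.and (hb.and (hc.and (hd.and (he.and hf))))).and
      ((Filter.eventually_mem_set.2 (hV₁.mem_nhds hz₁)).and
        (Filter.eventually_mem_set.2 (hV₂.mem_nhds hz₂))))
  have hB₁ : ball z ρ ⊆ V₁ := fun w hw ↦ (hball w hw).2.1
  have hB₂ : ball z ρ ⊆ V₂ := fun w hw ↦ (hball w hw).2.2
  have hBW : ball z ρ ⊆ W := hB₁.trans hVW₁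
  have hXB := hX.mono hB₁
  have hYB := hY.mono hB₂
  have hzB : z ∈ ball z ρ := mem_ball_self hρ
  have heq := (h.isParallelOn.mono hBW).eqOn (hXB.isParallelOn hYB isOpen_ball s t) isOpen_ball
    (convex_ball z ρ) (fun w hw ↦ (hball w hw).1) hzB (by rw [hXx, hYx, hp]; ring)
    (by rw [hXx, hYx, hXy, hYy, hq]) (by rw [hXy, hYy, hr]; ring)
  have hjac : ∀ w ∈ ball z ρ, px X w * py Y w - py X w * px Y w ≠ 0 := by
    intro w hw h0
    -- The discriminant $pr-q^2$ equals $st$ times the squared Jacobian, so nondegeneracy of the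
    -- metric gives a nonzero Jacobian.
    refine h.nondeg w (hBW hw) ?_
    obtain ⟨e1, e2, e3⟩ := heq w hw
    rw [e1, e2, e3]
    linear_combination s * t * (px X w * py Y w - py X w * px Y w) * h0
  obtain ⟨V, hV, hzV, hVB, hinj⟩ := exists_injOn_of_jacobian_ne_zero isOpen_ball hXB.smooth
    hYB.smooth hzB (hjac z hzB)
  refine ⟨V, X, Y, hV, hzV, hVB.trans hBW, ⟨s, t, hs, ht, fun w hw ↦ ?_⟩,
    (hXB.mono hVB).linearizedBy (hYB.mono hVB) hV (fun w hw ↦ h.proj_h w (hBW (hVB hw)))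
      (fun w hw ↦ h.proj_g w (hBW (hVB hw))) (fun w hw ↦ hjac w (hVB hw)) hinj⟩
  obtain ⟨e1, e2, e3⟩ := heq w (hVB hw)
  exact ⟨by rw [e1]; ring, e2, by rw [e3]; ring⟩

end Parallel

/-! ### Lie's criteria and existence of a consistent flat metric. -/

theorem px_sub {F H : ℝ × ℝ → ℝ} {z : ℝ × ℝ} (hF : DifferentiableAt ℝ F z)
    (hH : DifferentiableAt ℝ H z) : px (fun w ↦ F w - H w) z = px F z - px H z := by
  have h : HasFDerivAt (fun w ↦ F w - H w) _ z := hF.hasFDerivAt.sub hH.hasFDerivAt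
  rw [px_eq h, px_eq hF.hasFDerivAt, px_eq hH.hasFDerivAt]; rfl

theorem py_sub {F H : ℝ × ℝ → ℝ} {z : ℝ × ℝ} (hF : DifferentiableAt ℝ F z)
    (hH : DifferentiableAt ℝ H z) : py (fun w ↦ F w - H w) z = py F z - py H z := by
  have h : HasFDerivAt (fun w ↦ F w - H w) _ z := hF.hasFDerivAt.sub hH.hasFDerivAt
  rw [py_eq h, py_eq hF.hasFDerivAt, py_eq hH.hasFDerivAt]; rfl

/-- The system for the two free coefficients `b, e` of a flat connection projecting to `R`. -/
structure Root.IsFlatLift (R : Root) (b e : ℝ × ℝ → ℝ) (V : Set (ℝ × ℝ)) : Prop where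
  b_smooth : Smooth b V
  e_smooth : Smooth e V
  b_x : ∀ z ∈ V, px b z = -1 / 3 * py R.h z + -2 / 3 * px R.g z + R.c z * R.d z - b z * e z
  e_x : ∀ z ∈ V, px e z = py R.d z - R.d z * R.g z - R.h z * e z - e z ^ 2 - b z * R.d z
  b_y : ∀ z ∈ V, py b z = px R.c z - R.c z * R.h z - e z * R.c z - b z ^ 2 - b z * R.g z
  e_y : ∀ z ∈ V, py e z = -2 / 3 * py R.h z + -1 / 3 * px R.g z + R.c z * R.d z - b z * e z

section FlatLift

variable {R : Root} {U V : Set (ℝ × ℝ)}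

/-- Lie's criteria are the compatibility conditions of the system for a flat lift. -/
theorem Root.LieCriteria.exists_isFlatLift (hlie : R.LieCriteria U) (hU : IsOpen U)
    (hR : R.SmoothOn U) {z : ℝ × ℝ} (hz : z ∈ U) :
    ∃ (V : Set (ℝ × ℝ)) (b e : ℝ × ℝ → ℝ), IsOpen V ∧ z ∈ V ∧ V ⊆ U ∧ R.IsFlatLift b e V := by
  obtain ⟨sc, sg, sh, sd⟩ := hR
  set Q : ℝ × ℝ → ℝ := fun w ↦ -1 / 3 * py R.h w + -2 / 3 * px R.g w + R.c w * R.d w with hQ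
  set P : ℝ × ℝ → ℝ := fun w ↦ -2 / 3 * py R.h w + -1 / 3 * px R.g w + R.c w * R.d w with hP
  set M : ℝ × ℝ → ℝ := fun w ↦ py R.d w - R.d w * R.g w with hM
  set N : ℝ × ℝ → ℝ := fun w ↦ px R.c w - R.c w * R.h w with hN
  have sQ : Smooth Q U :=
    (((sh.py hU).const_mul _).add ((sg.px hU).const_mul _)).add (sc.mul sd)
  have sP : Smooth P U :=
    (((sh.py hU).const_mul _).add ((sg.px hU).const_mul _)).add (sc.mul sd)
  have sM : Smooth M U := (sd.py hU).sub (sd.mul sg)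
  have sN : Smooth N U := (sc.px hU).sub (sc.mul sh)
  have hQy : ∀ w ∈ U, py Q w = -1 / 3 * py (py R.h) w + -2 / 3 * py (px R.g) w
      + (py R.c w * R.d w + R.c w * py R.d w) := fun w hw ↦ by
    have h1 := ((sh.py hU).const_mul (-1 / 3)).differentiableAt hU hw
    have h2 := ((sg.px hU).const_mul (-2 / 3)).differentiableAt hU hw
    have h3 := (((sh.py hU).const_mul (-1 / 3)).add
      ((sg.px hU).const_mul (-2 / 3))).differentiableAt hU hw
    rw [hQ, py_add h3 ((sc.mul sd).differentiableAt hU hw), py_add h1 h2, py_const_mul,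
      py_const_mul, py_mul (sc.differentiableAt hU hw) (sd.differentiableAt hU hw)]
  have hPx : ∀ w ∈ U, px P w = -2 / 3 * py (px R.h) w + -1 / 3 * px (px R.g) w
      + (px R.c w * R.d w + R.c w * px R.d w) := fun w hw ↦ by
    have h1 := ((sh.py hU).const_mul (-2 / 3)).differentiableAt hU hw
    have h2 := ((sg.px hU).const_mul (-1 / 3)).differentiableAt hU hw
    have h3 := (((sh.py hU).const_mul (-2 / 3)).add
      ((sg.px hU).const_mul (-1 / 3))).differentiableAt hU hw
    rw [hP, px_add h3 ((sc.mul sd).differentiableAt hU hw), px_add h1 h2, px_const_mul,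
      px_const_mul, px_mul (sc.differentiableAt hU hw) (sd.differentiableAt hU hw), sh.px_py hU hw]
  have hMy : ∀ w ∈ U, py M w = py (py R.d) w - py (fun w ↦ R.d w * R.g w) w := fun w hw ↦
    py_sub ((sd.py hU).differentiableAt hU hw) ((sd.mul sg).differentiableAt hU hw)
  have hNx : ∀ w ∈ U, px N w = px (px R.c) w - px (fun w ↦ R.c w * R.h w) w := fun w hw ↦
    px_sub ((sc.px hU).differentiableAt hU hw) ((sc.mul sh).differentiableAt hU hw)
  -- The inhomogeneous terms become opaque, so only the derivatives just recorded enter the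
  -- compatibility check.
  clear_value Q P M N
  set F₁ : (ℝ × ℝ) × (ℝ × ℝ) → ℝ × ℝ := fun p ↦
    (Q p.1 - p.2.1 * p.2.2, M p.1 - R.h p.1 * p.2.2 - p.2.2 * p.2.2 - p.2.1 * R.d p.1) with hF₁
  set F₂ : (ℝ × ℝ) × (ℝ × ℝ) → ℝ × ℝ := fun p ↦
    (N p.1 - p.2.2 * R.c p.1 - p.2.1 * p.2.1 - p.2.1 * R.g p.1, P p.1 - p.2.1 * p.2.2) with hF₂
  have cQ := sQ.contDiffOn_comp_fst (E := ℝ × ℝ)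
  have cP := sP.contDiffOn_comp_fst (E := ℝ × ℝ)
  have cM := sM.contDiffOn_comp_fst (E := ℝ × ℝ)
  have cN := sN.contDiffOn_comp_fst (E := ℝ × ℝ)
  have cc := sc.contDiffOn_comp_fst (E := ℝ × ℝ)
  have cg := sg.contDiffOn_comp_fst (E := ℝ × ℝ)
  have ch := sh.contDiffOn_comp_fst (E := ℝ × ℝ)
  have cd := sd.contDiffOn_comp_fst (E := ℝ × ℝ)
  have hcomp : ∀ w ∈ U ×ˢ (univ : Set (ℝ × ℝ)),
      fderiv ℝ F₁ w ((0, 1), F₂ w) = fderiv ℝ F₂ w ((1, 0), F₁ w) := by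
    rintro w ⟨hw, -⟩
    have dQ := sQ.hasFDerivAt_comp_fst hU hw
    have dP := sP.hasFDerivAt_comp_fst hU hw
    have dM := sM.hasFDerivAt_comp_fst hU hw
    have dN := sN.hasFDerivAt_comp_fst hU hw
    have dc := sc.hasFDerivAt_comp_fst hU hw
    have dg := sg.hasFDerivAt_comp_fst hU hw
    have dh := sh.hasFDerivAt_comp_fst hU hw
    have dd := sd.hasFDerivAt_comp_fst hU hw
    have hs : HasFDerivAt (fun p : (ℝ × ℝ) × (ℝ × ℝ) ↦ p.2.1) _ w :=
      (hasFDerivAt_id (𝕜 := ℝ) w).snd.fst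
    have ht : HasFDerivAt (fun p : (ℝ × ℝ) × (ℝ × ℝ) ↦ p.2.2) _ w :=
      (hasFDerivAt_id (𝕜 := ℝ) w).snd.snd
    have h₁ : HasFDerivAt F₁ _ w := (dQ.sub (hs.mul ht)).prodMk
      (((dM.sub (dh.mul ht)).sub (ht.mul ht)).sub (hs.mul dd))
    have h₂ : HasFDerivAt F₂ _ w := (((dN.sub (ht.mul dc)).sub (hs.mul hs)).sub
      (hs.mul dg)).prodMk (dP.sub (hs.mul ht))
    rw [h₁.fderiv, h₂.fderiv]
    have l1 := hlie.first _ hw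
    have l2 := hlie.second _ hw
    have mc := px_mul (sc.differentiableAt hU hw) (sh.differentiableAt hU hw)
    have md := py_mul (sd.differentiableAt hU hw) (sg.differentiableAt hU hw)
    simp [hF₁, hF₂, hQy _ hw, hPx _ hw, hMy _ hw, hNx _ hw]
    simp only [hQ, hP, hM, hN]
    -- All terms in the unknowns cancel: $b_{xy}=b_{yx}$ amounts to Lie's first criterion and
    -- $e_{xy}=e_{yx}$ to the second.
    constructor
    · linear_combination (1 / 3) * l1
    · linear_combination (-1 / 3) * l2
  have cs : ContDiffOn ℝ ∞ (fun p : (ℝ × ℝ) × (ℝ × ℝ) ↦ p.2.1) (U ×ˢ univ) := by fun_prop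
  have ct : ContDiffOn ℝ ∞ (fun p : (ℝ × ℝ) × (ℝ × ℝ) ↦ p.2.2) (U ×ˢ univ) := by fun_prop
  have c₁ : ContDiffOn ℝ ∞ F₁ (U ×ˢ univ) := (cQ.sub (cs.mul ct)).prodMk
    (((cM.sub (ch.mul ct)).sub (ct.mul ct)).sub (cs.mul cd))
  have c₂ : ContDiffOn ℝ ∞ F₂ (U ×ˢ univ) := (((cN.sub (ct.mul cc)).sub (cs.mul cs)).sub
    (cs.mul cg)).prodMk (cP.sub (cs.mul ct))
  obtain ⟨V, hV, hzV, v, -, hvs, hv⟩ := exists_solution_total_differential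
    (hU.prod isOpen_univ) (F := F₁) (G := F₂) c₁ c₂ hcomp
    (z₀ := z) (v₀ := 0) ⟨hz, mem_univ _⟩
  refine ⟨V, fun w ↦ (v w).1, fun w ↦ (v w).2, hV, hzV, fun w hw ↦ (hv w hw).1.1,
    contDiff_fst.comp_contDiffOn hvs, contDiff_snd.comp_contDiffOn hvs, fun w hw ↦ ?_,
    fun w hw ↦ ?_, fun w hw ↦ ?_, fun w hw ↦ ?_⟩
  · rw [px_eq (hv w hw).2.fst]; simp [hF₁, hQ]
  · rw [px_eq (hv w hw).2.snd]; simp [hF₁, hM]; ring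
  · rw [py_eq (hv w hw).2.fst]; simp [hF₂, hN]; ring
  · rw [py_eq (hv w hw).2.snd]; simp [hF₂, hP]

/-- With $a=h+2e$ and $f=g+2b$, the first and fourth flatness equations are linear in $b_x,e_y$, and
solving them gives the equations of the lift; the second and third give $b_y$ and $e_x$. Flatness
does not involve the metric, so `p q r` are arbitrary. -/
theorem Root.IsFlatLift.isFlatOn {b e : ℝ × ℝ → ℝ} (h : R.IsFlatLift b e V) (hV : IsOpen V)
    (hR : R.SmoothOn V) (p q r : ℝ × ℝ → ℝ) :
    Geometry.IsFlatOn ⟨fun w ↦ R.h w + 2 * e w, b, e, fun w ↦ R.g w + 2 * b w, p, q, r⟩ R V := by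
  have ha : ∀ z ∈ V, py (fun w ↦ R.h w + 2 * e w) z = py R.h z + 2 * py e z := fun z hz ↦ by
    rw [py_add (hR.h.differentiableAt hV hz) ((h.e_smooth.const_mul 2).differentiableAt hV hz),
      py_const_mul]
  have hf : ∀ z ∈ V, px (fun w ↦ R.g w + 2 * b w) z = px R.g z + 2 * px b z := fun z hz ↦ by
    rw [px_add (hR.g.differentiableAt hV hz) ((h.b_smooth.const_mul 2).differentiableAt hV hz),
      px_const_mul]
  refine ⟨hR, hR.h.add (h.e_smooth.const_mul 2), h.b_smooth, h.e_smooth,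
    hR.g.add (h.b_smooth.const_mul 2), ?_, ?_, ?_, ?_⟩ <;> intro z hz <;> simp only
  · rw [ha z hz, h.e_y z hz, h.b_x z hz]; ring
  · rw [h.b_y z hz]; ring
  · rw [h.e_x z hz]; ring
  · rw [ha z hz, hf z hz, h.e_y z hz, h.b_x z hz]; ring

/-- Lie's criteria provide a flat metric whose geodesics project to the second order equation. -/
theorem Root.LieCriteria.exists_consistent (hlie : R.LieCriteria U) (hU : IsOpen U)
    (hR : R.SmoothOn U) {z : ℝ × ℝ} (hz : z ∈ U) :
    ∃ (W : Set (ℝ × ℝ)) (G : Geometry), IsOpen W ∧ z ∈ W ∧ W ⊆ U ∧ G.Consistent R W := by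
  obtain ⟨V, b, e, hV, hzV, hVU, hbe⟩ := hlie.exists_isFlatLift hU hR hz
  have hRV := hR.mono hVU
  -- The zero metric entries are placeholders until the affine functions are available.
  set G₀ : Geometry := ⟨fun w ↦ R.h w + 2 * e w, b, e, fun w ↦ R.g w + 2 * b w, 0, 0, 0⟩ with hG₀
  have hflat : G₀.IsFlatOn R V := hbe.isFlatOn hV hRV 0 0 0
  obtain ⟨V₁, X, hV₁, hz₁, hVW₁, hX, hXx, hXy⟩ := hflat.exists_isAffineOn hV hzV 1 0
  obtain ⟨V₂, Y, hV₂, hz₂, hVW₂, hY, hYx, hYy⟩ := hflat.exists_isAffineOn hV hzV 0 1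
  have hV₁₂ := hV₁.inter hV₂
  have hX' := hX.mono (V := V₁ ∩ V₂) inter_subset_left
  have hY' := hY.mono (V := V₁ ∩ V₂) inter_subset_right
  have hpar := hX'.isParallelOn hY' hV₁₂ 1 1
  have hJ : Smooth (fun w ↦ px X w * py Y w - py X w * px Y w) (V₁ ∩ V₂) :=
    ((hX'.smooth.px hV₁₂).mul (hY'.smooth.py hV₁₂)).sub
      ((hX'.smooth.py hV₁₂).mul (hY'.smooth.px hV₁₂))
  -- For the metric $dX^2+dY^2$ the discriminant $pr-q^2$ is the squared Jacobian; at `z` the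
  -- Jacobian is 1 by the choice of differentials.
  set W := (V₁ ∩ V₂) ∩ (fun w ↦ px X w * py Y w - py X w * px Y w) ⁻¹' {0}ᶜ with hW
  have hWo : IsOpen W := hJ.continuousOn.isOpen_inter_preimage hV₁₂ isOpen_compl_singleton
  have hWV₁₂ : W ⊆ V₁ ∩ V₂ := inter_subset_left
  have hWV : W ⊆ V := hWV₁₂.trans (inter_subset_left.trans hVW₁)
  have hparW := hpar.mono hWV₁₂
  refine ⟨W, ⟨G₀.a, b, e, G₀.f, fun z ↦ 1 * (px X z * px X z) + 1 * (px Y z * px Y z),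
    fun z ↦ 1 * (px X z * py X z) + 1 * (px Y z * py Y z),
    fun z ↦ 1 * (py X z * py X z) + 1 * (py Y z * py Y z)⟩, hWo, ⟨⟨hz₁, hz₂⟩, by simp [hXx, hXy, hYx, hYy]⟩,
    hWV.trans hVU,
    { smooth := ⟨hflat.a.mono hWV, hflat.b.mono hWV, hflat.e.mono hWV, hflat.f.mono hWV,
        hparW.p_smooth, hparW.q_smooth, hparW.r_smooth⟩
      proj_h := fun w _ ↦ by simp [hG₀]
      proj_g := fun w _ ↦ by simp [hG₀]
      flat1 := fun w hw ↦ hflat.flat1 w (hWV hw)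
      flat2 := fun w hw ↦ hflat.flat2 w (hWV hw)
      flat3 := fun w hw ↦ hflat.flat3 w (hWV hw)
      flat4 := fun w hw ↦ ?_
      p_x := hparW.p_x
      q_x := hparW.q_x
      r_x := hparW.r_x
      p_y := hparW.p_y
      q_y := hparW.q_y
      r_y := hparW.r_y
      nondeg := fun w hw ↦ ?_ }⟩
  · have hw' := hWV hw
    have h1 := px_add (hflat.b.differentiableAt hV hw') (hflat.f.differentiableAt hV hw')
    have h2 := py_add (hflat.a.differentiableAt hV hw') (hflat.e.differentiableAt hV hw')
    exact h1.trans ((hflat.flat4 w hw').trans h2.symm)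
  · have : (px X w * py Y w - py X w * px Y w) ^ 2 ≠ 0 := pow_ne_zero 2 hw.2
    convert this using 1
    ring

end FlatLift

end CondLin

/-! ### The main theorem. -/

theorem theorem3 (U : Set (ℝ × ℝ)) (hU : IsOpen U) (Q : CondLin.FourthOrder)
    (hQ : Q.SmoothOn U) (hA : ∀ z ∈ U, Q.A2 z ≠ 0)
    (hcon : Q.Constraints U) (hlie : Q.root.LieCriteria U) :
    Q.ConditionallyLinearizable Q.root U ∧
    (∀ z ∈ U, ∃ (W : Set (ℝ × ℝ)) (G : CondLin.Geometry),
      IsOpen W ∧ z ∈ W ∧ W ⊆ U ∧ G.Consistent Q.root W) ∧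
    (∀ (W : Set (ℝ × ℝ)) (G : CondLin.Geometry), IsOpen W → W ⊆ U → G.Consistent Q.root W →
      ∀ z ∈ W, ∃ (V : Set (ℝ × ℝ)) (X Y : ℝ × ℝ → ℝ), IsOpen V ∧ z ∈ V ∧ V ⊆ W ∧
        G.IsCartesian X Y V ∧ Q.root.LinearizedBy X Y V) := by
  have hR := hQ.root hU hA
  refine ⟨⟨hcon.arisesFrom hU hQ hA, fun _ _ hI h ↦ hcon.isSolution hU hQ hA hI h,
    fun z hz ↦ ?_⟩, fun z hz ↦ hlie.exists_consistent hU hR hz,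
    fun W G hW hWU hG z hz ↦ hG.exists_isCartesian hW (hR.mono hWU) hz⟩
  -- Local linearizability is obtained from Cartesian coordinates of any consistent metric near `z`.
  obtain ⟨W, G, hW, hzW, hWU, hG⟩ := hlie.exists_consistent hU hR hz
  obtain ⟨V, X, Y, hV, hzV, hVW, -, hlin⟩ := hG.exists_isCartesian hW (hR.mono hWU) hzW
  exact ⟨V, X, Y, hV, hzV, hVW.trans hWU, hlin⟩
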